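/- **Setting.** Let $k$ be a commutative ring and $(U,A,s,t,\Delta,\varepsilon)$ a left bialgebroid over $k$, with source map $s:A\to U$, target map $t:A^{\rm op}\to U$, coproduct $\Delta(u)=u_{(1)}\otimes_A u_{(2)}$ and counit $\varepsilon:U\to A$. Write $a\rhd u\lhd b:=s(a)t(b)u$ and $a\blacktriangleright u\blacktriangleleft b:=u\,s(b)t(a)$; the coproduct takes values in $U_\lhd\otimes_A{}_\rhd U$. Assume that $U$ is a left Hopf algebroid, that is, the map ${}_\blacktriangleright U\otimes_{A^{\rm op}}U_\lhd\to U_\lhd\otimes_A{}_\rhd U$, $u\otimes v\mapsto u_{(1)}\otimes u_{(2)}v$, is bijective, and write $u_+\otimes_{A^{\rm op}}u_-$ for the preimage of $u\otimes_A 1$. Assume that the right $A$-module $U_\lhd$ is finitely generated projective. Let $U^*:=\mathrm{Hom}_{A^{\rm op}}(U_\lhd,A)$, with left $U$-action $(u\rightharpoonup\phi)(v):=\varepsilon\big(u_+\,t(\phi(u_-v))\big)$. A dual basis consists of $e_1,\dots,e_n\in U$ and $e^1,\dots,e^n\in U^*$ with $u=\sum_j e_j\lhd e^j(u)$ for all $u\in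 U$. *Contramodules.* A right $U$-contramodule is a right $A$-module $M$ with a map $\gamma_M:\mathrm{Hom}_{A^{\rm op}}(U_\lhd,M)\to M$ such that $\gamma_M(f(s(a)\,-))=\gamma_M(f)a$, $\gamma_M(m\,\varepsilon(-))=m$, and $\gamma_M\big(u\mapsto\gamma_M(h(u))\big)=\gamma_M\big(u\mapsto h(u_{(1)})(u_{(2)})\big)$ for all $h\in\mathrm{Hom}_{A^{\rm op}}(U_\lhd,\mathrm{Hom}_{A^{\rm op}}(U_\lhd,M))$, where $\mathrm{Hom}_{A^{\rm op}}(U_\lhd,M)$ is a right $A$-module by $fa:=f(s(a)\,-)$. It carries the left $A$-action $am:=\gamma_M\big(m\,\varepsilon(-\,s(a))\big)$. *Comodules.* A left $U$-comodule is a left $A$-module $N$ with a coassociative, counital, left $A$-linear coaction $N\to U_\lhd\otimes_A N$, $n\mapsto n_{(-1)}\otimes_A n_{(0)}$. It carries the right $A$-action $na:=\varepsilon(n_{(-1)}s(a))\,n_{(0)}$. *aYD contramodules.* An anti Yetter–Drinfel'd (aYD) contramodule $M$ is a right $U$-contramodule and left $U$-module such that $s(a)t(b)m=amb$ for all $a,b\in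 A$, $m\in M$, and $u\,\gamma_M(f)=\gamma_M\big(w\mapsto u_{(2)+}f(u_{(2)-}\,w\,u_{(1)})\big)$ for all $u\in U$, $f\in\mathrm{Hom}_{A^{\rm op}}(U_\lhd,M)$. *Yetter–Drinfel'd modules.* A Yetter–Drinfel'd module $N$ is a left $U$-comodule and left $U$-module such that $s(a)t(b)n=anb$ for all $a,b\in A$, $n\in N$, and $(u_{(1)}n)_{(-1)}u_{(2)}\otimes_A(u_{(1)}n)_{(0)}=u_{(1)}n_{(-1)}\otimes_A u_{(2)}n_{(0)}$ for all $u\in U$, $n\in N$. **Proposition.** 1. Let $M$ be a right $U$-contramodule and $N$ a left $U$-comodule. Then $M\otimes_A N$, with right $A$-action $(m\otimes_A n)a=m\otimes_A na$, is a right $U$-contramodule by means of the contraaction $$\gamma(f)=\sum_j\gamma_M\Big(f(e_j)'\,\big(f(e_j)''_{(-1)}\rightharpoonup e^j\big)(-)\Big)\otimes_A f(e_j)''_{(0)},\qquad f\in\mathrm{Hom}_{A^{\rm op}}(U_\lhd,M\otimes_A N),$$ where $f(u)=f(u)'\otimes_A f(u)''$ (summation understood); the formula holds for every dual basis $(e_j),(e^j)$.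 2. Let $M$ be an aYD contramodule and $N$ a Yetter–Drinfel'd module. Then $M\otimes_A N$, with the right $A$-action and the contraaction of part 1 and with the diagonal left $U$-action $u(m\otimes_A n)=u_{(1)}m\otimes_A u_{(2)}n$, is an aYD contramodule. -/

import Mathlib

open scoped TensorProduct
open MulOpposite

/-! ### Balanced tensor products of `k`-modules over a not necessarily commutative ring -/

section Balanced

variable {k : Type*} [CommRing k] {A : Type*}
variable {M : Type*} [AddCommGroup M] [Module k M] {N : Type*} [AddCommGroup N] [Module k N]
variable {M' : Type*} [AddCommGroup M'] [Module k M'] {N' : Type*} [AddCommGroup N'] [Module k N']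
variable {P : Type*} [AddCommGroup P] [Module k P]

/-- The submodule of `M ⊗[k] N` spanned by all `(m · a) ⊗ n - m ⊗ (a · n)`, where `m · a` is
`ρ a m` and `a · n` is `l a n`. -/
def balRel (ρ : A → Module.End k M) (l : A → Module.End k N) : Submodule k (M ⊗[k] N) :=
  Submodule.span k {x | ∃ a m n, x = ρ a m ⊗ₜ[k] n - m ⊗ₜ[k] l a n}

/-- The balanced tensor product: `M ⊗[k] N` modulo `(m · a) ⊗ n = m ⊗ (a · n)`. For a right
`A`-action `ρ` and a left `A`-action `l` that extend the `k`-actions it is `M ⊗_A N`. -/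
abbrev BalTensor (ρ : A → Module.End k M) (l : A → Module.End k N) : Type _ :=
  (M ⊗[k] N) ⧸ balRel ρ l

namespace BalTensor

/-- The class of `m ⊗ n`, as a bilinear map. -/
def mk (ρ : A → Module.End k M) (l : A → Module.End k N) : M →ₗ[k] N →ₗ[k] BalTensor ρ l :=
  (TensorProduct.mk k M N).compr₂ (balRel ρ l).mkQ

theorem mk_rel (ρ : A → Module.End k M) (l : A → Module.End k N) (a : A) (m : M) (n : N) :
    mk ρ l (ρ a m) n = mk ρ l m (l a n) := by
  have : ρ a m ⊗ₜ[k] n - m ⊗ₜ[k] l a n ∈ balRel ρ l := Submodule.subset_span ⟨a, m, n, rfl⟩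
  exact (Submodule.Quotient.eq _).2 this

/-- Balanced bilinear maps factor through the balanced tensor product. -/
def lift {ρ : A → Module.End k M} {l : A → Module.End k N} (B : M →ₗ[k] N →ₗ[k] P)
    (hB : ∀ a m n, B (ρ a m) n = B m (l a n)) : BalTensor ρ l →ₗ[k] P :=
  (balRel ρ l).liftQ (TensorProduct.lift B) (by
    refine Submodule.span_le.2 ?_
    rintro _ ⟨a, m, n, rfl⟩
    simp [hB])

@[simp]
theorem lift_mk {ρ : A → Module.End k M} {l : A → Module.End k N} (B : M →ₗ[k] N →ₗ[k] P)
    (hB : ∀ a m n, B (ρ a m) n = B m (l a n)) (m : M) (n : N) :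
    lift B hB (mk ρ l m n) = B m n :=
  TensorProduct.lift.tmul m n

theorem hom_ext {ρ : A → Module.End k M} {l : A → Module.End k N} {f g : BalTensor ρ l →ₗ[k] P}
    (h : ∀ m n, f (mk ρ l m n) = g (mk ρ l m n)) : f = g := by
  apply Submodule.linearMap_qext
  apply TensorProduct.ext'
  exact h

/-- `f ⊗ g` on balanced tensor products. -/
def map {ρ : A → Module.End k M} {l : A → Module.End k N} {ρ' : A → Module.End k M'}
    {l' : A → Module.End k N'} (f : M →ₗ[k] M') (g : N →ₗ[k] N')
    (hf : ∀ a m, f (ρ a m) = ρ' a (f m)) (hg : ∀ a n, g (l a n) = l' a (g n)) :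
    BalTensor ρ l →ₗ[k] BalTensor ρ' l' :=
  lift ((mk ρ' l').compl₁₂ f g) (by intro a m n; simp [hf, hg, mk_rel])

@[simp]
theorem map_mk {ρ : A → Module.End k M} {l : A → Module.End k N} {ρ' : A → Module.End k M'}
    {l' : A → Module.End k N'} (f : M →ₗ[k] M') (g : N →ₗ[k] N')
    (hf : ∀ a m, f (ρ a m) = ρ' a (f m)) (hg : ∀ a n, g (l a n) = l' a (g n)) (m : M) (n : N) :
    map f g hf hg (mk ρ l m n) = mk ρ' l' (f m) (g n) :=
  lift_mk _ _ m n

end BalTensor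

end Balanced

/-! ### `A ⊗ Aᵒᵖ`-rings -/

/-- A `k`-algebra `U` with a `k`-algebra map `A ⊗ Aᵒᵖ → U`, given by its source map `s` and its
target map `t`, which have commuting images. -/
structure AeRing (k A U : Type*) [CommRing k] [Ring A] [Algebra k A] [Ring U] [Algebra k U] where
  s : A →ₐ[k] U
  t : Aᵐᵒᵖ →ₐ[k] U
  s_t_comm : ∀ a b, s a * t b = t b * s a

namespace AeRing

variable {k A U : Type*} [CommRing k] [Ring A] [Algebra k A] [Ring U] [Algebra k U]
variable (E : AeRing k A U)
variable {M : Type*} [AddCommGroup M] [Module k M] {N : Type*} [AddCommGroup N] [Module k N]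

/-- `a ▷ u = s(a) u`, as a left action of `A` on `U`. -/
def ls : A →ₐ[k] Module.End k U := (Algebra.lmul k U).comp E.s

/-- `u ◁ a = t(a) u`. -/
def rt (a : A) : Module.End k U := LinearMap.mulLeft k (E.t (op a))

/-- `a ▶ u = u t(a)`. -/
def lt (a : A) : Module.End k U := LinearMap.mulRight k (E.t (op a))

/-- `u ◀ a = u s(a)`. -/
def rs (a : A) : Module.End k U := LinearMap.mulRight k (E.s a)

@[simp] theorem ls_apply (a : A) (u : U) : E.ls a u = E.s a * u := rfl
@[simp] theorem rt_apply (a : A) (u : U) : E.rt a u = E.t (op a) * u := rfl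
@[simp] theorem lt_apply (a : A) (u : U) : E.lt a u = u * E.t (op a) := rfl
@[simp] theorem rs_apply (a : A) (u : U) : E.rs a u = u * E.s a := rfl

/-- `U_◁ ⊗_A N` for a left `A`-module `N` with action `l`. -/
abbrev UTensor (l : A → Module.End k N) : Type _ := BalTensor E.rt l

/-- `U_◁ ⊗_A ▷U`. -/
abbrev UU : Type _ := E.UTensor (⇑E.ls)

/-- `▶U ⊗_{Aᵒᵖ} U_◁`, that is, `u t(a) ⊗ v = u ⊗ t(a) v`. -/
abbrev UUop : Type _ := BalTensor E.lt E.rt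

/-- The left `A`-action `a (u ⊗ n) = s(a) u ⊗ n` on `U_◁ ⊗_A N`. -/
def sTensor (l : A → Module.End k N) (a : A) : Module.End k (E.UTensor l) :=
  BalTensor.map (E.ls a) LinearMap.id (by
    intro b u
    simp [← mul_assoc, E.s_t_comm]) (by simp)

@[simp]
theorem sTensor_mk (l : A → Module.End k N) (a : A) (u : U) (n : N) :
    E.sTensor l a (BalTensor.mk E.rt l u n) = BalTensor.mk E.rt l (E.s a * u) n :=
  BalTensor.map_mk _ _ _ _ _ _

/-- The map `u ⊗ n ↦ u v ⊗ n` on `U_◁ ⊗_A N`. -/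
def fstMulRight (l : A → Module.End k N) (v : U) : Module.End k (E.UTensor l) :=
  BalTensor.map (LinearMap.mulRight k v) LinearMap.id (by simp [mul_assoc]) (by simp)

@[simp]
theorem fstMulRight_mk (l : A → Module.End k N) (v u : U) (n : N) :
    E.fstMulRight l v (BalTensor.mk E.rt l u n) = BalTensor.mk E.rt l (u * v) n :=
  BalTensor.map_mk _ _ _ _ _ _

/-- The map `u ⊗ u' ↦ u ⊗ u' v` on `U_◁ ⊗_A ▷U`. -/
def sndMulRightAux (v : U) : Module.End k E.UU :=
  BalTensor.map LinearMap.id (LinearMap.mulRight k v) (by simp) (by simp [mul_assoc])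

theorem sndMulRightAux_mk (v x y : U) :
    E.sndMulRightAux v (BalTensor.mk E.rt E.ls x y) = BalTensor.mk E.rt E.ls x (y * v) :=
  BalTensor.map_mk _ _ _ _ _ _

/-- The map `u ⊗ u' ↦ u ⊗ u' v` on `U_◁ ⊗_A ▷U`, linear also in `v`. -/
def sndMulRight : U →ₗ[k] Module.End k E.UU where
  toFun := E.sndMulRightAux
  map_add' v w := by
    apply BalTensor.hom_ext
    intro x y
    simp [sndMulRightAux_mk, mul_add]
  map_smul' c v := by
    apply BalTensor.hom_ext
    intro x y
    simp [sndMulRightAux_mk]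

@[simp]
theorem sndMulRight_mk (v x y : U) :
    E.sndMulRight v (BalTensor.mk E.rt E.ls x y) = BalTensor.mk E.rt E.ls x (y * v) :=
  E.sndMulRightAux_mk v x y

/-- The map `u ⊗ u' ↦ u ⊗ t(a) u'` on `U_◁ ⊗_A ▷U`. -/
def tTensor (a : A) : Module.End k E.UU :=
  BalTensor.map LinearMap.id (E.rt a) (by simp) (by
    intro b u
    simp [← mul_assoc, E.s_t_comm])

@[simp]
theorem tTensor_mk (a : A) (x y : U) :
    E.tTensor a (BalTensor.mk E.rt E.ls x y) = BalTensor.mk E.rt E.ls x (E.t (op a) * y) :=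
  BalTensor.map_mk _ _ _ _ _ _

theorem sndMulRight_mul (v w : U) (z : E.UU) :
    E.sndMulRight (v * w) z = E.sndMulRight w (E.sndMulRight v z) := by
  have : E.sndMulRight (v * w) = E.sndMulRight w ∘ₗ E.sndMulRight v := by
    apply BalTensor.hom_ext
    intro x y
    simp [mul_assoc]
  exact LinearMap.congr_fun this z

theorem sndMulRight_sTensor (a : A) (v : U) (z : E.UU) :
    E.sndMulRight v (E.sTensor E.ls a z) = E.sTensor E.ls a (E.sndMulRight v z) := by
  have : E.sndMulRight v ∘ₗ E.sTensor E.ls a = E.sTensor E.ls a ∘ₗ E.sndMulRight v := by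
    apply BalTensor.hom_ext
    intro x y
    simp
  exact LinearMap.congr_fun this z

theorem sndMulRight_tTensor (a : A) (v : U) (z : E.UU) :
    E.sndMulRight v (E.tTensor a z) = E.tTensor a (E.sndMulRight v z) := by
  have : E.sndMulRight v ∘ₗ E.tTensor a = E.tTensor a ∘ₗ E.sndMulRight v := by
    apply BalTensor.hom_ext
    intro x y
    simp [mul_assoc]
  exact LinearMap.congr_fun this z

/-- The map `(u ⊗ v, n) ↦ u ⊗ (v ⊗ n)` from `U_◁ ⊗_A ▷U` and `N` to `U_◁ ⊗_A (U_◁ ⊗_A N)`. -/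
def assocMap (l : A → Module.End k N) : E.UU →ₗ[k] N →ₗ[k] E.UTensor (E.sTensor l) :=
  BalTensor.lift
    (LinearMap.mk₂ k (fun u v => (BalTensor.mk E.rt (E.sTensor l) u).comp (BalTensor.mk E.rt l v))
      (by intros; ext; simp) (by intros; ext; simp) (by intros; ext; simp)
      (by intros; ext; simp))
    (by
      intro a u v
      ext n
      simp only [LinearMap.mk₂_apply, LinearMap.comp_apply]
      rw [BalTensor.mk_rel, sTensor_mk]
      rfl)

@[simp]
theorem assocMap_mk (l : A → Module.End k N) (u v : U) (n : N) :
    E.assocMap l (BalTensor.mk E.rt E.ls u v) n =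
      BalTensor.mk E.rt (E.sTensor l) u (BalTensor.mk E.rt l v n) :=
  LinearMap.congr_fun (BalTensor.lift_mk _ _ u v) n

/-- For `D : U → U_◁ ⊗_A ▷U` with `D(t(a)u) = D(u) ◁ a`, the map
`D ⊗ N : U_◁ ⊗_A N → U_◁ ⊗_A (U_◁ ⊗_A N)`. -/
def comulTensor (D : U →ₗ[k] E.UU) (hD : ∀ a u, D (E.t (op a) * u) = E.tTensor a (D u))
    (l : A → Module.End k N) : E.UTensor l →ₗ[k] E.UTensor (E.sTensor l) :=
  BalTensor.lift ((E.assocMap l).comp D) (by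
    intro a u n
    have key : (E.assocMap l).flip n ∘ₗ E.tTensor a = (E.assocMap l).flip (l a n) := by
      apply BalTensor.hom_ext
      intro x y
      simp only [LinearMap.comp_apply, tTensor_mk, LinearMap.flip_apply, assocMap_mk]
      rw [← BalTensor.mk_rel E.rt l]
      rfl
    simpa [hD] using LinearMap.congr_fun key (D u))

/-- For a left `A`-linear `c : N → U_◁ ⊗_A N`, the map `U ⊗ c : U_◁ ⊗_A N → U_◁ ⊗_A (U_◁ ⊗_A N)`. -/
def idTensor (l : A → Module.End k N) (c : N →ₗ[k] E.UTensor l)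
    (hc : ∀ a n, c (l a n) = E.sTensor l a (c n)) :
    E.UTensor l →ₗ[k] E.UTensor (E.sTensor l) :=
  BalTensor.map LinearMap.id c (fun _ _ => rfl) hc

/-- `Hom_{Aᵒᵖ}(U_◁, M)` for a right `A`-module `M` with action `ρ`: the maps `f` with
`f(t(a)u) = f(u) a`. -/
def HomA (ρ : Aᵐᵒᵖ →ₐ[k] Module.End k M) : Submodule k (U →ₗ[k] M) where
  carrier := {f | ∀ a u, f (E.t a * u) = ρ a (f u)}
  add_mem' := by intro f g hf hg a u; simp [hf a u, hg a u]
  zero_mem' := by intro a u; simp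
  smul_mem' := by intro c f hf a u; simp [hf a u]

instance (ρ : Aᵐᵒᵖ →ₐ[k] Module.End k M) : CoeFun (E.HomA ρ) (fun _ => U → M) :=
  ⟨fun f => f.1⟩

theorem HomA.map_t {E : AeRing k A U} {ρ : Aᵐᵒᵖ →ₐ[k] Module.End k M} (f : E.HomA ρ) (a : Aᵐᵒᵖ)
    (u : U) : f (E.t a * u) = ρ a (f u) := f.2 a u

/-- The right `A`-action `(f a)(u) = f(s(a) u)` on `Hom_{Aᵒᵖ}(U_◁, M)`. -/
def homRact (ρ : Aᵐᵒᵖ →ₐ[k] Module.End k M) : Aᵐᵒᵖ →ₐ[k] Module.End k (E.HomA ρ) :=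
  AlgHom.ofLinearMap
    (LinearMap.mk₂ k
      (fun a f => (⟨f.1.comp (LinearMap.mulLeft k (E.s a.unop)), by
        intro b u
        have : E.s a.unop * (E.t b * u) = E.t b * (E.s a.unop * u) := by
          rw [← mul_assoc, E.s_t_comm, mul_assoc]
        simp only [LinearMap.comp_apply, LinearMap.mulLeft_apply]
        rw [this]
        exact f.2 b _⟩ : E.HomA ρ))
      (by intros; ext; simp [add_mul]) (by intros; ext; simp) (by intros; ext; simp)
      (by intros; ext; simp))
    (by ext; simp) (by intros; ext; simp)

@[simp]
theorem homRact_apply (ρ : Aᵐᵒᵖ →ₐ[k] Module.End k M) (a : Aᵐᵒᵖ) (f : E.HomA ρ) (u : U) :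
    (E.homRact ρ a f) u = f (E.s a.unop * u) := rfl

/-- Precomposition with right multiplication by `x`, that is `f ↦ f((-) x)`. -/
def homMulRight (ρ : Aᵐᵒᵖ →ₐ[k] Module.End k M) : U →ₗ[k] E.HomA ρ →ₗ[k] E.HomA ρ :=
  LinearMap.mk₂ k
    (fun x f => ⟨f.1.comp (LinearMap.mulRight k x), by
      intro b u
      simpa [mul_assoc] using f.2 b (u * x)⟩)
    (by intros; ext; simp [mul_add]) (by intros; ext; simp) (by intros; ext; simp)
    (by intros; ext; simp)

/-- Postcomposition `Hom_{Aᵒᵖ}(U, g)` with a map `g` of right `A`-modules. -/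
def homPost {ρ : Aᵐᵒᵖ →ₐ[k] Module.End k M} {ρ' : Aᵐᵒᵖ →ₐ[k] Module.End k N} (g : M →ₗ[k] N)
    (hg : ∀ a m, g (ρ a m) = ρ' a (g m)) (f : E.HomA ρ) : E.HomA ρ' :=
  ⟨g.comp f.1, by intro a u; simp [f.2 a u, hg]⟩

/-- `A` as a right module over itself. -/
def regR (k A : Type*) [CommRing k] [Ring A] [Algebra k A] : Aᵐᵒᵖ →ₐ[k] Module.End k A :=
  Algebra.lsmul k k A

@[simp] theorem regR_apply (a : Aᵐᵒᵖ) (b : A) : regR k A a b = b * a.unop := rfl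

/-- The right dual `U^* = Hom_{Aᵒᵖ}(U_◁, A)`. -/
abbrev Dual : Type _ := E.HomA (regR k A)

/-- The element `m⟨φ, -⟩ : u ↦ m φ(u)` of `Hom_{Aᵒᵖ}(U_◁, M)`. -/
def rankOne (ρ : Aᵐᵒᵖ →ₐ[k] Module.End k M) : M →ₗ[k] E.Dual →ₗ[k] E.HomA ρ :=
  LinearMap.mk₂ k
    (fun m φ => ⟨(ρ.toLinearMap.flip m).comp
        ((opLinearEquiv k (M := A)).toLinearMap.comp φ.1), by
      intro a u
      simp [φ.2 a u]⟩)
    (by intros; ext; simp) (by intros; ext; simp) (by intros; ext; simp)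
    (by intros; ext; simp)

@[simp]
theorem rankOne_apply (ρ : Aᵐᵒᵖ →ₐ[k] Module.End k M) (m : M) (φ : E.Dual) (u : U) :
    (E.rankOne ρ m φ) u = ρ (op (φ u)) m := rfl

/-- The map `u ⊗ n ↦ φ(u) n` from `U_◁ ⊗_A N` to `N`, for `φ` in `U^*`. -/
def pair (l : A →ₐ[k] Module.End k N) (φ : E.Dual) : E.UTensor (⇑l) →ₗ[k] N :=
  BalTensor.lift (l.toLinearMap.comp φ.1) (by
    intro a u n
    have : φ.1 (E.t (op a) * u) = φ.1 u * a := φ.2 (op a) u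
    simp [this])

/-- The map `u ⊗ v ↦ t(φ(v)) u` from `U_◁ ⊗_A ▷U` to `U`, for `φ : U → A` with
`φ(s(a)v) = a φ(v)`. -/
def pairRight (φ : U →ₗ[k] A) (hφ : ∀ a v, φ (E.s a * v) = a * φ v) : E.UU →ₗ[k] U :=
  BalTensor.lift
    (((LinearMap.mul k U).comp
      (E.t.toLinearMap.comp ((opLinearEquiv k (M := A)).toLinearMap.comp φ))).flip)
    (by intro a x y; simp [hφ, mul_assoc])

/-- `U_◁`, the right `A`-module `U` with `u ◁ a = t(a) u`, is finitely generated projective. -/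
def FGProjective : Prop :=
  letI : Module Aᵐᵒᵖ U := Module.compHom U (E.t : Aᵐᵒᵖ →+* U)
  Module.Finite Aᵐᵒᵖ U ∧ Module.Projective Aᵐᵒᵖ U

/-- A dual basis of `U_◁`: elements `e_i` of `U` and `e^i` of `U^*` with
`u = ∑ i, e_i ◁ e^i(u) = ∑ i, t(e^i(u)) e_i` for all `u`. -/
def IsDualBasis {n : ℕ} (e : Fin n → U) (e' : Fin n → E.Dual) : Prop :=
  ∀ u, u = ∑ i, E.t (op (e' i u)) * e i

end AeRing

/-! ### Left bialgebroids -/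

/-- A left bialgebroid `(U, A, s, t, Δ, ε)`. -/
structure LeftBialgebroid (k A U : Type*) [CommRing k] [Ring A] [Algebra k A] [Ring U]
    [Algebra k U] extends AeRing k A U where
  /-- the coproduct -/
  Δ : U →ₗ[k] toAeRing.UU
  /-- the counit -/
  ε : U →ₗ[k] A
  -- both are maps of `A`-bimodules for `a ▷ u ◁ b = s(a) t(b) u`
  Δ_s : ∀ a u, Δ (s a * u) = toAeRing.sTensor toAeRing.ls a (Δ u)
  Δ_t : ∀ a u, Δ (t (op a) * u) = toAeRing.tTensor a (Δ u)
  ε_s : ∀ a u, ε (s a * u) = a * ε u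
  ε_t : ∀ a u, ε (t a * u) = ε u * a.unop
  /-- `(Δ ⊗ U) Δ = (U ⊗ Δ) Δ` in `U ⊗_A U ⊗_A U` -/
  coassoc : ∀ u, toAeRing.comulTensor Δ Δ_t toAeRing.ls (Δ u) =
    toAeRing.idTensor toAeRing.ls Δ Δ_s (Δ u)
  /-- `s(ε(u₁)) u₂ = u` -/
  counit_left : ∀ u, toAeRing.pair toAeRing.ls ⟨ε, ε_t⟩ (Δ u) = u
  /-- `t(ε(u₂)) u₁ = u` -/
  counit_right : ∀ u, toAeRing.pairRight ε ε_s (Δ u) = u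
  /-- `u₁ t(a) ⊗ u₂ = u₁ ⊗ u₂ s(a)`: the coproduct has values in the Sweedler-Takeuchi product -/
  takeuchi : ∀ a u, toAeRing.fstMulRight toAeRing.ls (t (op a)) (Δ u) = toAeRing.sndMulRight (s a) (Δ u)
  Δ_one : Δ 1 = BalTensor.mk toAeRing.rt toAeRing.ls 1 1
  /-- `Δ(uv) = Δ(u) Δ(v)`, the product being factorwise; by `takeuchi` it does not depend on the
  representatives `X` and `Y` -/
  Δ_mul : ∀ (u v : U) (X Y : U ⊗[k] U), Submodule.Quotient.mk X = Δ u →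
    Submodule.Quotient.mk Y = Δ v → Δ (u * v) = Submodule.Quotient.mk (X * Y)
  ε_one : ε 1 = 1
  ε_mul_s : ∀ u v, ε (u * v) = ε (u * s (ε v))
  ε_mul_t : ∀ u v, ε (u * v) = ε (u * t (op (ε v)))

namespace LeftBialgebroid

variable {k A U : Type*} [CommRing k] [Ring A] [Algebra k A] [Ring U] [Algebra k U]
variable (H : LeftBialgebroid k A U)
variable {M : Type*} [AddCommGroup M] [Module k M] {N : Type*} [AddCommGroup N] [Module k N]

/-- The counit as an element of `U^*`. -/
def counitDual : H.Dual := ⟨H.ε, H.ε_t⟩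

/-- The element `ε((-) s(a))` of `U^*`. -/
def sDual (a : A) : H.Dual := H.homMulRight _ (H.s a) H.counitDual

@[simp] theorem sDual_apply (a : A) (u : U) : (H.sDual a) u = H.ε (u * H.s a) := rfl

theorem Δ_mul_t (u : U) (a : A) : H.Δ (u * H.t (op a)) = H.sndMulRight (H.t (op a)) (H.Δ u) := by
  obtain ⟨X, hX⟩ := Submodule.Quotient.mk_surjective _ (H.Δ u)
  have h1 : H.Δ (H.t (op a)) = Submodule.Quotient.mk (1 ⊗ₜ[k] H.t (op a)) := by
    have := H.Δ_t a 1
    rw [mul_one, H.Δ_one] at this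
    rw [this]
    simp
    rfl
  rw [H.Δ_mul u _ X _ hX h1.symm, ← hX]
  have key : (balRel H.rt (⇑H.ls)).mkQ ∘ₗ LinearMap.mulRight k (1 ⊗ₜ[k] H.t (op a)) =
      H.sndMulRight (H.t (op a)) ∘ₗ (balRel H.rt (⇑H.ls)).mkQ := by
    apply TensorProduct.ext'
    intro x y
    have := H.sndMulRight_mk (H.t (op a)) x y
    simp only [LinearMap.comp_apply, LinearMap.mulRight_apply,
      Algebra.TensorProduct.tmul_mul_tmul, mul_one]
    exact this.symm
  exact LinearMap.congr_fun key X

/-- The Hopf-Galois map `▶U ⊗_{Aᵒᵖ} U_◁ → U_◁ ⊗_A ▷U`, `u ⊗ v ↦ u₁ ⊗ u₂ v`. -/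
def galois : H.UUop →ₗ[k] H.UU :=
  BalTensor.lift (H.sndMulRight.flip.comp H.Δ) (by
    intro a u v
    simp only [AeRing.lt_apply, AeRing.rt_apply, LinearMap.comp_apply, LinearMap.flip_apply]
    rw [H.Δ_mul_t, ← LinearMap.comp_apply]
    congr 1
    apply BalTensor.hom_ext
    intro x y
    simp [mul_assoc])

@[simp]
theorem galois_mk (u v : U) : H.galois (BalTensor.mk H.lt H.rt u v) = H.sndMulRight v (H.Δ u) :=
  BalTensor.lift_mk _ _ u v

/-- A left bialgebroid is a left Hopf algebroid if its Hopf-Galois map is bijective. -/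
def IsLeftHopf : Prop := Function.Bijective H.galois

variable {H}

/-- The translation map `u ↦ u₊ ⊗ u₋`, where `u₊ ⊗ u₋` is the element of `▶U ⊗_{Aᵒᵖ} U_◁` that
the Hopf-Galois map sends to `u ⊗ 1`. -/
noncomputable def translation (hH : H.IsLeftHopf) : U →ₗ[k] H.UUop :=
  (LinearEquiv.ofBijective H.galois hH).symm.toLinearMap.comp
    ((BalTensor.mk H.rt (⇑H.ls)).flip 1)

theorem galois_translation (hH : H.IsLeftHopf) (u : U) :
    H.galois (translation hH u) = BalTensor.mk _ _ u 1 := by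
  simp only [translation, LinearMap.comp_apply, LinearMap.flip_apply]
  exact (LinearEquiv.ofBijective H.galois hH).apply_symm_apply _

/-- The map `u ⊗ v ↦ x u ⊗ v` on `▶U ⊗_{Aᵒᵖ} U_◁`. -/
def opL (x : U) : Module.End k H.UUop :=
  BalTensor.map (LinearMap.mulLeft k x) LinearMap.id (by simp [mul_assoc]) (by simp)

@[simp]
theorem opL_mk (x u v : U) :
    opL x (BalTensor.mk H.lt H.rt u v) = BalTensor.mk H.lt H.rt (x * u) v :=
  BalTensor.map_mk _ _ _ _ _ _

/-- The map `u ⊗ v ↦ u ⊗ v x` on `▶U ⊗_{Aᵒᵖ} U_◁`. -/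
def opR (x : U) : Module.End k H.UUop :=
  BalTensor.map LinearMap.id (LinearMap.mulRight k x) (by simp) (by simp [mul_assoc])

@[simp]
theorem opR_mk (x u v : U) :
    opR x (BalTensor.mk H.lt H.rt u v) = BalTensor.mk H.lt H.rt u (v * x) :=
  BalTensor.map_mk _ _ _ _ _ _

theorem galois_opR (x : U) (z : H.UUop) :
    H.galois (opR x z) = H.sndMulRight x (H.galois z) := by
  have : H.galois ∘ₗ opR x = H.sndMulRight x ∘ₗ H.galois := by
    apply BalTensor.hom_ext
    intro u v
    simp only [LinearMap.comp_apply, opR_mk, galois_mk]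
    exact H.sndMulRight_mul v x (H.Δ u)
  exact LinearMap.congr_fun this z

theorem galois_opL_s (a : A) (z : H.UUop) :
    H.galois (opL (H.s a) z) = H.sTensor _ a (H.galois z) := by
  have : H.galois ∘ₗ opL (H.s a) = H.sTensor _ a ∘ₗ H.galois := by
    apply BalTensor.hom_ext
    intro u v
    simp only [LinearMap.comp_apply, opL_mk, galois_mk, H.Δ_s]
    exact H.sndMulRight_sTensor a v (H.Δ u)
  exact LinearMap.congr_fun this z

theorem galois_opL_t (a : A) (z : H.UUop) :
    H.galois (opL (H.t (op a)) z) = H.tTensor a (H.galois z) := by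
  have : H.galois ∘ₗ opL (H.t (op a)) = H.tTensor a ∘ₗ H.galois := by
    apply BalTensor.hom_ext
    intro u v
    simp only [LinearMap.comp_apply, opL_mk, galois_mk, H.Δ_t]
    exact H.sndMulRight_tTensor a v (H.Δ u)
  exact LinearMap.congr_fun this z

/-- `t(a) u₊ ⊗ u₋ = u₊ ⊗ u₋ t(a)`. -/
theorem translation_takeuchi (hH : H.IsLeftHopf) (a : A) (u : U) :
    opL (H.t (op a)) (translation hH u) = opR (H.t (op a)) (translation hH u) := by
  apply hH.1
  rw [galois_opR, galois_opL_t, galois_translation]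
  simp

/-- `(t(a)u)₊ ⊗ (t(a)u)₋ = u₊ ⊗ u₋ s(a)`. -/
theorem translation_t_mul (hH : H.IsLeftHopf) (a : A) (u : U) :
    translation hH (H.t (op a) * u) = opR (H.s a) (translation hH u) := by
  apply hH.1
  rw [galois_opR, galois_translation, galois_translation]
  simpa using BalTensor.mk_rel H.rt (⇑H.ls) a u 1

/-- `(s(a)u)₊ ⊗ (s(a)u)₋ = s(a) u₊ ⊗ u₋`. -/
theorem translation_s_mul (hH : H.IsLeftHopf) (a : A) (u : U) :
    translation hH (H.s a * u) = opL (H.s a) (translation hH u) := by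
  apply hH.1
  rw [galois_opL_s, galois_translation, galois_translation]
  simp

/-- For a left `U`-module `M` with `t(a) m = m a` and `f` in `Hom_{Aᵒᵖ}(U_◁, M)`, the map that
sends `x ⊗ y` in `▶U ⊗_{Aᵒᵖ} U_◁` to `w ↦ x f(y w)`. -/
def adjAux (act : U →ₐ[k] Module.End k M) (ρ : Aᵐᵒᵖ →ₐ[k] Module.End k M)
    (h : ∀ a, act (H.t a) = ρ a) (f : H.HomA ρ) : H.UUop →ₗ[k] (U →ₗ[k] M) :=
  BalTensor.lift
    (LinearMap.mk₂ k (fun x y => (act x).comp (f.1.comp (LinearMap.mulLeft k y)))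
      (by intros; ext; simp) (by intros; ext; simp) (by intros; ext; simp [add_mul])
      (by intros; ext; simp))
    (by
      intro a x y
      ext w
      simp only [LinearMap.mk₂_apply, AeRing.lt_apply, AeRing.rt_apply, LinearMap.comp_apply,
        LinearMap.mulLeft_apply, map_mul, h, Module.End.mul_apply, mul_assoc]
      rw [f.2])

@[simp]
theorem adjAux_mk (act : U →ₐ[k] Module.End k M) (ρ : Aᵐᵒᵖ →ₐ[k] Module.End k M)
    (h : ∀ a, act (H.t a) = ρ a) (f : H.HomA ρ) (x y w : U) :
    adjAux act ρ h f (BalTensor.mk H.lt H.rt x y) w = act x (f (y * w)) :=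
  LinearMap.congr_fun (BalTensor.lift_mk _ _ x y) w

/-- The left `U`-action `(u ⇀ f)(w) = u₊ f(u₋ w)` on `Hom_{Aᵒᵖ}(U_◁, M)`, for a left `U`-module
`M` with underlying right `A`-module structure `m a = t(a) m`; here as a linear map in `u`. -/
noncomputable def adj (hH : H.IsLeftHopf) (act : U →ₐ[k] Module.End k M)
    (ρ : Aᵐᵒᵖ →ₐ[k] Module.End k M) (h : ∀ a, act (H.t a) = ρ a) (f : H.HomA ρ) :
    U →ₗ[k] H.HomA ρ :=
  ((adjAux act ρ h f).comp (translation hH)).codRestrict (H.HomA ρ) (by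
    intro u a w
    induction a with | _ a
    have h1 : ∀ z, adjAux act ρ h f z (H.t (op a) * w) =
        adjAux act ρ h f (opR (H.t (op a)) z) w := by
      intro z
      have : (adjAux act ρ h f).flip (H.t (op a) * w) =
          (adjAux act ρ h f).flip w ∘ₗ opR (H.t (op a)) := by
        apply BalTensor.hom_ext
        intro x y
        simp [mul_assoc]
      exact LinearMap.congr_fun this z
    have h2 : ∀ z, ρ (op a) (adjAux act ρ h f z w) =
        adjAux act ρ h f (opL (H.t (op a)) z) w := by
      intro z
      have : ρ (op a) ∘ₗ (adjAux act ρ h f).flip w =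
          (adjAux act ρ h f).flip w ∘ₗ opL (H.t (op a)) := by
        apply BalTensor.hom_ext
        intro x y
        simp [h]
      exact LinearMap.congr_fun this z
    simp only [LinearMap.comp_apply]
    rw [h1, h2, translation_takeuchi])

theorem adj_apply (hH : H.IsLeftHopf) (act : U →ₐ[k] Module.End k M)
    (ρ : Aᵐᵒᵖ →ₐ[k] Module.End k M) (h : ∀ a, act (H.t a) = ρ a) (f : H.HomA ρ) (u w : U) :
    (adj hH act ρ h f u) w = adjAux act ρ h f (translation hH u) w := rfl

variable (H)

/-- The base algebra as a left `U`-module: `u · a = ε(u t(a))`. -/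
def baseAct : U →ₐ[k] Module.End k A :=
  AlgHom.ofLinearMap
    (LinearMap.mk₂ k (fun u a => H.ε (u * H.t (op a)))
      (by intros; simp [add_mul]) (by intros; simp) (by intros; simp [mul_add])
      (by intros; simp))
    (by ext a; simpa [H.ε_one] using H.ε_t (op a) 1)
    (by intro u v; ext a; simp [mul_assoc, H.ε_mul_t u (v * _)])

@[simp] theorem baseAct_apply (u : U) (a : A) : H.baseAct u a = H.ε (u * H.t (op a)) := rfl

theorem baseAct_t (a : Aᵐᵒᵖ) : H.baseAct (H.t a) = AeRing.regR k A a := by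
  ext b
  have := H.ε_t (a * op b) 1
  simp only [mul_one, map_mul, H.ε_one, one_mul] at this
  simpa using this

variable {H}

/-- The left `U`-action `(u ⇀ φ)(v) = ε(u₊ t(φ(u₋ v)))` on `U^*`, as a linear map in `u`. -/
noncomputable def adjDual (hH : H.IsLeftHopf) (φ : H.Dual) : U →ₗ[k] H.Dual :=
  adj hH H.baseAct (AeRing.regR k A) H.baseAct_t φ

variable (H)

/-- For `h` in `Hom_{Aᵒᵖ}(U, Hom_{Aᵒᵖ}(U, M))`, the map `U_◁ ⊗_A ▷U → M`, `u ⊗ v ↦ h(u)(v)`. -/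
def uncurryHom {ρ : Aᵐᵒᵖ →ₐ[k] Module.End k M} (h : H.HomA (H.homRact ρ)) : H.UU →ₗ[k] M :=
  BalTensor.lift ((H.HomA ρ).subtype.comp h.1) (by
    intro a u v
    have : h.1 (H.t (op a) * u) = H.homRact ρ (op a) (h.1 u) := h.2 (op a) u
    simp only [AeRing.rt_apply, LinearMap.comp_apply, this]
    rfl)

theorem uncurryHom_mk {ρ : Aᵐᵒᵖ →ₐ[k] Module.End k M} (h : H.HomA (H.homRact ρ)) (u v : U) :
    H.uncurryHom h (BalTensor.mk H.rt H.ls u v) = (h.1 u).1 v :=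
  BalTensor.lift_mk _ _ u v

/-- For `h` in `Hom_{Aᵒᵖ}(U, Hom_{Aᵒᵖ}(U, M))`, the map `u ↦ h(u₁)(u₂)`. -/
def homComul {ρ : Aᵐᵒᵖ →ₐ[k] Module.End k M} (h : H.HomA (H.homRact ρ)) : H.HomA ρ :=
  ⟨(H.uncurryHom h).comp H.Δ, by
    intro a u
    induction a with | _ a
    have key : H.uncurryHom h ∘ₗ H.tTensor a = ρ (op a) ∘ₗ H.uncurryHom h := by
      apply BalTensor.hom_ext
      intro x y
      simp only [LinearMap.comp_apply, AeRing.tTensor_mk, uncurryHom_mk]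
      exact (h.1 x).2 (op a) y
    simp only [LinearMap.comp_apply, H.Δ_t]
    exact LinearMap.congr_fun key (H.Δ u)⟩

end LeftBialgebroid

/-! ### Contramodules, comodules, and their (anti) Yetter-Drinfel'd versions -/

section Coefficients

variable {k A U : Type*} [CommRing k] [Ring A] [Algebra k A] [Ring U] [Algebra k U]

/-- The structure of a right contramodule over a left bialgebroid on `M`: a right `A`-module
structure `ract` and a contraaction `γ : Hom_{Aᵒᵖ}(U_◁, M) → M`. -/
structure RightContramodule (H : LeftBialgebroid k A U) (M : Type*) [AddCommGroup M]
    [Module k M] where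
  ract : Aᵐᵒᵖ →ₐ[k] Module.End k M
  γ : H.HomA ract →ₗ[k] M
  /-- `γ(f(s(a) -)) = γ(f) a` -/
  γ_ract : ∀ a f, γ (H.homRact ract a f) = ract a (γ f)
  /-- contraassociativity: `γ(u ↦ γ(h(u))) = γ(u ↦ h(u₁)(u₂))` -/
  γ_assoc : ∀ h : H.HomA (H.homRact ract), γ (H.homPost γ γ_ract h) = γ (H.homComul h)
  /-- `γ(m ε(-)) = m` -/
  γ_unit : ∀ m, γ (H.rankOne ract m H.counitDual) = m

/-- The left `A`-action `a m = γ(m ε((-) s(a)))` on a right contramodule. -/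
def RightContramodule.lact {H : LeftBialgebroid k A U} {M : Type*} [AddCommGroup M] [Module k M]
    (C : RightContramodule H M) (a : A) (m : M) : M :=
  C.γ (H.rankOne C.ract m (H.sDual a))

/-- The structure of a left comodule over a left bialgebroid on `N`: a left `A`-module structure
`lact` and a coassociative and counital left `A`-linear coaction `N → U_◁ ⊗_A N`. -/
structure LeftComodule (H : LeftBialgebroid k A U) (N : Type*) [AddCommGroup N]
    [Module k N] where
  lact : A →ₐ[k] Module.End k N
  coact : N →ₗ[k] H.UTensor (⇑lact)
  coact_lact : ∀ a n, coact (lact a n) = H.sTensor lact a (coact n)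
  coassoc : ∀ n, H.comulTensor H.Δ H.Δ_t lact (coact n) =
    H.idTensor lact coact coact_lact (coact n)
  counit : ∀ n, H.pair lact H.counitDual (coact n) = n

/-- The right `A`-action `n a = ε(n₋₁ s(a)) n₀` on a left comodule. -/
def LeftComodule.ract {H : LeftBialgebroid k A U} {N : Type*} [AddCommGroup N] [Module k N]
    (D : LeftComodule H N) (a : A) : Module.End k N :=
  (H.pair D.lact (H.sDual a)).comp D.coact

/-- An anti Yetter-Drinfel'd contramodule over a left Hopf algebroid: a right contramodule which
is also a left `U`-module with the same underlying `A`-bimodule structure, such that action and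
contraaction are compatible. -/
structure AYDContramodule (H : LeftBialgebroid k A U) (hH : H.IsLeftHopf) (M : Type*)
    [AddCommGroup M] [Module k M] extends RightContramodule H M where
  act : U →ₐ[k] Module.End k M
  act_s : ∀ a m, act (H.s a) m = toRightContramodule.lact a m
  act_t : ∀ a, act (H.t a) = ract a
  /-- `u γ(f) = γ((u₂ ⇀ f)((-) u₁)) = γ(w ↦ u₂₊ f(u₂₋ w u₁))`. By the preceding fields the right
  hand side does not depend on the representative `X` of `u₁ ⊗ u₂`. -/
  compat : ∀ (u : U) (f : H.HomA ract) (X : U ⊗[k] U), Submodule.Quotient.mk X = H.Δ u →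
    act u (γ f) = TensorProduct.lift
      (((H.homMulRight ract).compl₂ (LeftBialgebroid.adj hH act ract act_t f)).compr₂ γ) X

/-- A Yetter-Drinfel'd module over a left bialgebroid: a left comodule which is also a left
`U`-module with the same underlying `A`-bimodule structure, such that action and coaction are
compatible. -/
structure YDModule (H : LeftBialgebroid k A U) (N : Type*) [AddCommGroup N] [Module k N]
    extends LeftComodule H N where
  act : U →ₐ[k] Module.End k N
  act_s : ∀ a, act (H.s a) = lact a
  act_t : ∀ a, act (H.t (op a)) = toLeftComodule.ract a
  /-- `(u₁ n)₋₁ u₂ ⊗ (u₁ n)₀ = u₁ n₋₁ ⊗ u₂ n₀`. By the preceding fields neither side depends on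
  the representatives `X = ∑ x ⊗ y` of `u₁ ⊗ u₂` and `Y` of `n₋₁ ⊗ n₀`. -/
  compat : ∀ (u : U) (n : N) (r : ℕ) (x y : Fin r → U) (Y : U ⊗[k] N),
    ∑ i, BalTensor.mk H.rt H.ls (x i) (y i) = H.Δ u → Submodule.Quotient.mk Y = coact n →
    ∑ i, H.fstMulRight lact (y i) (coact (act (x i) n)) =
      Submodule.Quotient.mk
        (∑ i, TensorProduct.map (LinearMap.mulLeft k (x i)) (act (y i)) Y)

variable {H : LeftBialgebroid k A U}
variable {M : Type*} [AddCommGroup M] [Module k M] {N : Type*} [AddCommGroup N] [Module k N]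

/-- `M ⊗_A N` for a right contramodule `M` and a left comodule `N`. -/
abbrev RightContramodule.tensor (C : RightContramodule H M) (D : LeftComodule H N) : Type _ :=
  BalTensor (fun a => C.ract (op a)) (⇑D.lact)

/-- The class of `m ⊗ n` in `M ⊗_A N`. -/
def RightContramodule.tmul (C : RightContramodule H M) (D : LeftComodule H N) :
    M →ₗ[k] N →ₗ[k] C.tensor D :=
  BalTensor.mk (fun a => C.ract (op a)) (⇑D.lact)

theorem RightContramodule.tmul_rel (C : RightContramodule H M) (D : LeftComodule H N) (a : A)
    (m : M) (n : N) : C.tmul D (C.ract (op a) m) n = C.tmul D m (D.lact a n) :=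
  BalTensor.mk_rel (fun a => C.ract (op a)) (⇑D.lact) a m n

/-- `(t(a) u) ⇀ φ = (u ⇀ φ)(s(a) -)`. -/
theorem LeftBialgebroid.adjDual_t_mul (hH : H.IsLeftHopf) (φ : H.Dual) (a : A) (u : U) :
    LeftBialgebroid.adjDual hH φ (H.t (op a) * u) =
      H.homRact _ (op a) (LeftBialgebroid.adjDual hH φ u) := by
  apply Subtype.ext
  ext w
  change LeftBialgebroid.adjAux H.baseAct (AeRing.regR k A) H.baseAct_t φ (LeftBialgebroid.translation hH (H.t (op a) * u)) w =
    LeftBialgebroid.adjAux H.baseAct (AeRing.regR k A) H.baseAct_t φ (LeftBialgebroid.translation hH u) (H.s a * w)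
  rw [LeftBialgebroid.translation_t_mul]
  have : (LeftBialgebroid.adjAux H.baseAct (AeRing.regR k A) H.baseAct_t φ).flip w ∘ₗ
      LeftBialgebroid.opR (H.s a) =
      (LeftBialgebroid.adjAux H.baseAct (AeRing.regR k A) H.baseAct_t φ).flip (H.s a * w) := by
    apply BalTensor.hom_ext
    intro x y
    simp [mul_assoc]
  exact LinearMap.congr_fun this _

/-- `((s(a) u) ⇀ φ)(w) = a (u ⇀ φ)(w)`. -/
theorem LeftBialgebroid.adjDual_s_mul (hH : H.IsLeftHopf) (φ : H.Dual) (a : A) (u w : U) :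
    (LeftBialgebroid.adjDual hH φ (H.s a * u)) w = a * (LeftBialgebroid.adjDual hH φ u) w := by
  change LeftBialgebroid.adjAux H.baseAct (AeRing.regR k A) H.baseAct_t φ (LeftBialgebroid.translation hH (H.s a * u)) w =
    a * LeftBialgebroid.adjAux H.baseAct (AeRing.regR k A) H.baseAct_t φ (LeftBialgebroid.translation hH u) w
  rw [LeftBialgebroid.translation_s_mul]
  have : (LeftBialgebroid.adjAux H.baseAct (AeRing.regR k A) H.baseAct_t φ).flip w ∘ₗ
      LeftBialgebroid.opL (H.s a) = LinearMap.mulLeft k a ∘ₗ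
      (LeftBialgebroid.adjAux H.baseAct (AeRing.regR k A) H.baseAct_t φ).flip w := by
    apply BalTensor.hom_ext
    intro x y
    simp only [LinearMap.comp_apply, LinearMap.flip_apply, LeftBialgebroid.opL_mk,
      LeftBialgebroid.adjAux_mk, LeftBialgebroid.baseAct_apply, mul_assoc, H.ε_s,
      LinearMap.mulLeft_apply]
  exact LinearMap.congr_fun this _

/-- The map `U_◁ ⊗_A N → M ⊗_A N`, `u ⊗ n ↦ γ(m⟨u ⇀ φ, -⟩) ⊗ n`, linear also in `m`. -/
noncomputable def RightContramodule.contraAux (hH : H.IsLeftHopf) (C : RightContramodule H M)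
    (D : LeftComodule H N) (φ : H.Dual) :
    H.UTensor (⇑D.lact) →ₗ[k] M →ₗ[k] C.tensor D :=
  BalTensor.lift
    (LinearMap.mk₂ k
      (fun u n => ((C.tmul D).flip n).comp
        (C.γ.comp ((H.rankOne C.ract).flip (LeftBialgebroid.adjDual hH φ u))))
      (by intros; ext; simp) (by intros; ext; simp) (by intros; ext; simp)
      (by intros; ext; simp))
    (by
      intro a u n
      ext m
      simp only [LinearMap.mk₂_apply, LinearMap.comp_apply, LinearMap.flip_apply,
        AeRing.rt_apply, ← RightContramodule.tmul_rel, LeftBialgebroid.adjDual_t_mul]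
      rw [← C.γ_ract]
      rfl)

/-- The map `M ⊗_A N → M ⊗_A N`, `m ⊗ n ↦ γ(m⟨n₋₁ ⇀ φ, -⟩) ⊗ n₀`, for `φ` in `U^*`. -/
noncomputable def RightContramodule.contraMap (hH : H.IsLeftHopf) (C : RightContramodule H M)
    (D : LeftComodule H N) (φ : H.Dual) : C.tensor D →ₗ[k] C.tensor D :=
  BalTensor.lift ((C.contraAux hH D φ).comp D.coact).flip (by
    intro a m n
    simp only [LinearMap.flip_apply, LinearMap.comp_apply, D.coact_lact]
    have : (C.contraAux hH D φ).flip (C.ract (op a) m) =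
        (C.contraAux hH D φ).flip m ∘ₗ H.sTensor _ a := by
      apply BalTensor.hom_ext
      intro u n
      simp only [contraAux, LinearMap.flip_apply, LinearMap.comp_apply, AeRing.sTensor,
        BalTensor.map_mk, BalTensor.lift_mk, LinearMap.mk₂_apply, LinearMap.id_apply,
        AeRing.ls_apply]
      have e : H.rankOne C.ract (C.ract (op a) m) (LeftBialgebroid.adjDual hH φ u) =
          H.rankOne C.ract m (LeftBialgebroid.adjDual hH φ (H.s a * u)) := ?_
      · rw [e]
      apply Subtype.ext
      ext w
      change C.ract (op _) (C.ract (op a) m) = C.ract (op _) m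
      rw [LeftBialgebroid.adjDual_s_mul, op_mul, map_mul]
      rfl
    exact LinearMap.congr_fun this (D.coact n))

/-- The map `U_◁ ⊗_A ▷U → M ⊗_A N`, `x ⊗ y ↦ x m ⊗ y n`, for an anti Yetter-Drinfel'd
contramodule `M` and a Yetter-Drinfel'd module `N`. The diagonal action of `u` on `m ⊗ n` is its
value at `u₁ ⊗ u₂`. -/
def AYDContramodule.diag {hH : H.IsLeftHopf} (C : AYDContramodule H hH M) (D : YDModule H N)
    (m : M) (n : N) :
    H.UU →ₗ[k] C.toRightContramodule.tensor D.toLeftComodule :=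
  BalTensor.lift
    ((C.toRightContramodule.tmul D.toLeftComodule).compl₁₂
      (C.act.toLinearMap.flip m) (D.act.toLinearMap.flip n)) (by
    intro a x y
    simpa [C.act_t, D.act_s] using C.toRightContramodule.tmul_rel D.toLeftComodule a _ _)

end Coefficients

/-! ### Sweedler sums on balanced tensor products. -/

namespace BalTensor

section Sweedler

variable {k : Type*} [CommRing k] {A : Type*}
variable {M : Type*} [AddCommGroup M] [Module k M] {N : Type*} [AddCommGroup N] [Module k N]
variable {P : Type*} [AddCommGroup P]
variable {ρ : A → Module.End k M} {l : A → Module.End k N}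

/-! Finite projectivity of $U_\lhd$ makes every $f\in\mathrm{Hom}_{A^{\rm op}}(U_\lhd,P)$ a finite
sum of rank one maps $z\langle\phi,-\rangle : u\mapsto z\phi(u)$ with $\phi\in U^*$. A contraaction
on $P=M\otimes_A N$ is therefore the same as an operation
$z\cdot\phi:=\gamma(z\langle\phi,-\rangle)$ that is $A$-balanced, right $A$-linear, unital for
$\varepsilon$, and associative for the product $(\psi\phi)(v)=\psi(s(\phi(v_1))v_2)$ on $U^*$. Here
$(m\otimes n)\cdot\phi=\gamma_M(m\langle n_{-1}\rightharpoonup\phi,-\rangle)\otimes n_0$, which is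
`contraMap`. The formula with a dual basis collapses to it on rank one maps (`tensorγ_rankOne`), so
it does not depend on the dual basis.

Associativity (`contraMap_conv`) combines contraassociativity of $M$, coassociativity of $N$ and the
module algebra identity
$u\rightharpoonup(\psi\phi)=(u_1\rightharpoonup\psi)(u_2\rightharpoonup\phi)$ (`adjDual_conv`).
Unitality uses $u\rightharpoonup\varepsilon=\varepsilon(u)\varepsilon$.

The main identities for $\rightharpoonup$ come from one characterisation instead of a calculus for
$u_+\otimes u_-$: bijectivity of the Galois map says that $u\rightharpoonup f$ is the only balanced
solution of $(u_1\rightharpoonup f)(u_2v)=u f(v)$ (`sw_adj`, `adj_unique`).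

For part 2 the compatibility is again checked on rank one maps, where $u\rightharpoonup
z\langle\phi,-\rangle=(u_1z)\langle u_2\rightharpoonup\phi,-\rangle$ (`adj_rankOne`) reduces it to
$u(z\cdot\phi)=(u_2z)\cdot(u_3\rightharpoonup\phi)((-)u_1)$ (`tensorAct_contraMap`). For $z=m\otimes
n$, the aYD condition on $M$ brings the left side, and the Yetter–Drinfel'd condition on $N$ the
right side, to the common form $\gamma_M\big((u_2m)\langle
u_3n_{-1}\rightharpoonup\phi((-)u_1),-\rangle\big)\otimes u_4n_0$. -/

theorem exists_eq_sum_mk (z : BalTensor ρ l) :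
    ∃ S : Finset (M × N), z = ∑ p ∈ S, mk ρ l p.1 p.2 := by
  obtain ⟨X, rfl⟩ := Submodule.Quotient.mk_surjective _ z
  obtain ⟨S, hS⟩ := TensorProduct.exists_finset X
  refine ⟨S, ?_⟩
  rw [hS]
  exact map_sum (balRel ρ l).mkQ _ _

/-- The Sweedler sum `∑ B(z₁, z₂)` over a chosen representative of `z = z₁ ⊗ z₂`. -/
noncomputable def sw (z : BalTensor ρ l) (B : M → N → P) : P :=
  ∑ p ∈ (exists_eq_sum_mk z).choose, B p.1 p.2

theorem sw_congr (z : BalTensor ρ l) {B B' : M → N → P} (h : ∀ m n, B m n = B' m n) :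
    sw z B = sw z B' :=
  Finset.sum_congr rfl fun p _ => h p.1 p.2

/-- Both representatives are fixed by choice, so this is an exchange of finite sums and needs no
balancedness. Balancedness matters only where the tensor itself is rewritten. -/
theorem sw_sw_comm {A' M' N' : Type*} [AddCommGroup M'] [Module k M'] [AddCommGroup N']
    [Module k N'] {ρ' : A' → Module.End k M'} {l' : A' → Module.End k N'}
    (z : BalTensor ρ l) (w : BalTensor ρ' l') (B : M → N → M' → N' → P) :
    sw z (fun m n => sw w (B m n)) = sw w (fun p q => sw z (fun m n => B m n p q)) :=
  Finset.sum_comm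

variable [Module k P] {Q : Type*} [AddCommGroup Q] [Module k Q]

/-- `B` is `k`-bilinear and balanced. -/
structure Bal (ρ : A → Module.End k M) (l : A → Module.End k N) (B : M → N → P) : Prop where
  intro ::
  left : ∀ n, IsLinearMap k (fun m => B m n)
  right : ∀ m, IsLinearMap k (B m)
  bal : ∀ a m n, B (ρ a m) n = B m (l a n)

/-- The linear map on the balanced tensor product given by a balanced bilinear function. -/
def Bal.lift {B : M → N → P} (h : Bal ρ l B) : BalTensor ρ l →ₗ[k] P :=
  BalTensor.lift (LinearMap.mk₂ k B (fun m m' n => (h.left n).map_add m m')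
    (fun c m n => (h.left n).map_smul c m) (fun m n n' => (h.right m).map_add n n')
    (fun c m n => (h.right m).map_smul c n)) h.bal

@[simp]
theorem Bal.lift_mk {B : M → N → P} (h : Bal ρ l B) (m : M) (n : N) :
    h.lift (mk ρ l m n) = B m n :=
  BalTensor.lift_mk _ _ m n

theorem map_sw (g : P →ₗ[k] Q) (z : BalTensor ρ l) (B : M → N → P) :
    g (sw z B) = sw z (fun m n => g (B m n)) :=
  map_sum g _ _

theorem sw_mk_eq (z : BalTensor ρ l) : sw z (fun m n => mk ρ l m n) = z :=
  (exists_eq_sum_mk z).choose_spec.symm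

theorem sw_eq_apply (F : BalTensor ρ l →ₗ[k] P) (z : BalTensor ρ l) :
    sw z (fun m n => F (mk ρ l m n)) = F z := by
  rw [← map_sw, sw_mk_eq]

/-- Balancedness removes the dependence on the chosen representative. Rewriting the tensor under a
Sweedler sum rests on this. -/
theorem Bal.sw_eq {B : M → N → P} (h : Bal ρ l B) (z : BalTensor ρ l) : sw z B = h.lift z := by
  rw [← sw_eq_apply h.lift z]
  simp

theorem Bal.sw_mk {B : M → N → P} (h : Bal ρ l B) (m : M) (n : N) :
    sw (mk ρ l m n) B = B m n := by
  rw [h.sw_eq, h.lift_mk]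

theorem Bal.sw_add {B : M → N → P} (h : Bal ρ l B) (z z' : BalTensor ρ l) :
    sw (z + z') B = sw z B + sw z' B := by
  simp [h.sw_eq]

theorem Bal.sw_smul {B : M → N → P} (h : Bal ρ l B) (c : k) (z : BalTensor ρ l) :
    sw (c • z) B = c • sw z B := by
  simp [h.sw_eq]

/-- A Sweedler sum is invariant under linear endomorphisms of the tensor product given on
elementary tensors. -/
theorem Bal.sw_apply {A' M' N' : Type*} [AddCommGroup M'] [Module k M'] [AddCommGroup N']
    [Module k N'] {ρ' : A' → Module.End k M'} {l' : A' → Module.End k N'} {B : M → N → P}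
    (h : Bal ρ l B) (F : BalTensor ρ' l' →ₗ[k] BalTensor ρ l) (f : M' → M) (g : N' → N)
    (hF : ∀ m n, F (mk ρ' l' m n) = mk ρ l (f m) (g n)) (z : BalTensor ρ' l') :
    sw (F z) B = sw z (fun m n => B (f m) (g n)) := by
  rw [h.sw_eq, ← LinearMap.comp_apply, ← sw_eq_apply]
  simp [hF]

/-- Translates between Sweedler sums and the aYD condition, which is stated for arbitrary
representatives in $U\otimes_kU$. -/
theorem Bal.lift_tensor {B : M →ₗ[k] N →ₗ[k] P} (h : Bal ρ l (fun m n => B m n)) (X : M ⊗[k] N) :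
    TensorProduct.lift B X = sw (Submodule.Quotient.mk X : BalTensor ρ l) (fun m n => B m n) := by
  rw [h.sw_eq]
  have : TensorProduct.lift B = h.lift ∘ₗ (balRel ρ l).mkQ := by
    apply TensorProduct.ext'
    intro m n
    exact (h.lift_mk m n).symm
  exact LinearMap.congr_fun this X

theorem Bal.comp {B : M → N → P} (h : Bal ρ l B) (g : P →ₗ[k] Q) :
    Bal ρ l (fun m n => g (B m n)) where
  left n := ⟨fun x y => by simp [(h.left n).map_add], fun c x => by simp [(h.left n).map_smul]⟩
  right m := ⟨fun x y => by simp [(h.right m).map_add], fun c x => by simp [(h.right m).map_smul]⟩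
  bal a m n := by simp [h.bal]

end Sweedler

end BalTensor

/-! ### Sweedler calculus for the coproduct. -/

namespace LeftBialgebroid

open BalTensor

variable {k A U : Type*} [CommRing k] [Ring A] [Algebra k A] [Ring U] [Algebra k U]
variable (H : LeftBialgebroid k A U)
variable {N : Type*} [AddCommGroup N] [Module k N]
variable {P : Type*} [AddCommGroup P] [Module k P]

section

variable {H} {l : A → Module.End k N}

/-- The linear map on `U ⊗_A (U ⊗_A N)` given by a balanced trilinear function. -/
def lift₃ {B : U → U → N → P} (h12 : ∀ n, Bal H.rt H.ls (fun u v => B u v n))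
    (h23 : ∀ u, Bal H.rt l (B u)) : H.UTensor (H.sTensor l) →ₗ[k] P :=
  BalTensor.lift
    { toFun := fun u => (h23 u).lift
      map_add' := fun u u' => by
        apply hom_ext
        intro v n
        simpa using ((h12 n).left v).map_add u u'
      map_smul' := fun c u => by
        apply hom_ext
        intro v n
        simpa using ((h12 n).left v).map_smul c u } (by
    intro a u z
    have : (h23 (H.rt a u)).lift = (h23 u).lift ∘ₗ H.sTensor l a := by
      apply hom_ext
      intro v n
      simpa using (h12 n).bal a u v
    exact LinearMap.congr_fun this z)

@[simp]
theorem lift₃_mk {B : U → U → N → P} (h12 : ∀ n, Bal H.rt H.ls (fun u v => B u v n))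
    (h23 : ∀ u, Bal H.rt l (B u)) (u : U) (z : H.UTensor l) :
    lift₃ h12 h23 (BalTensor.mk _ _ u z) = (h23 u).lift z :=
  BalTensor.lift_mk _ _ u z

/-- With `lift₃_idTensor`, turns a coassociativity axiom into an equality of iterated Sweedler sums.
A general left `A`-module in the last slot covers the coproduct and every coaction. -/
theorem lift₃_comulTensor {B : U → U → N → P} (h12 : ∀ n, Bal H.rt H.ls (fun u v => B u v n))
    (h23 : ∀ u, Bal H.rt l (B u)) (z : H.UTensor l) :
    lift₃ h12 h23 (H.comulTensor H.Δ H.Δ_t l z) =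
      sw z (fun u n => sw (H.Δ u) (fun x y => B x y n)) := by
  rw [← LinearMap.comp_apply, ← sw_eq_apply]
  refine sw_congr _ fun u n => ?_
  rw [(h12 n).sw_eq, LinearMap.comp_apply, AeRing.comulTensor, BalTensor.lift_mk,
    LinearMap.comp_apply]
  have : lift₃ h12 h23 ∘ₗ (H.assocMap l).flip n = (h12 n).lift := by
    apply hom_ext
    intro u v
    simp
  exact LinearMap.congr_fun this _

theorem lift₃_idTensor {B : U → U → N → P} (h12 : ∀ n, Bal H.rt H.ls (fun u v => B u v n))
    (h23 : ∀ u, Bal H.rt l (B u)) (c : N →ₗ[k] H.UTensor l)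
    (hc : ∀ a n, c (l a n) = H.sTensor l a (c n)) (z : H.UTensor l) :
    lift₃ h12 h23 (H.idTensor l c hc z) = sw z (fun u n => sw (c n) (B u)) := by
  rw [← LinearMap.comp_apply, ← sw_eq_apply]
  refine sw_congr _ fun u n => ?_
  rw [(h23 u).sw_eq, LinearMap.comp_apply, AeRing.idTensor, BalTensor.map_mk, lift₃_mk]

end

theorem sw_coassoc {B : U → U → U → P} (h12 : ∀ w, Bal H.rt H.ls (fun u v => B u v w))
    (h23 : ∀ u, Bal H.rt H.ls (B u)) (u : U) :
    sw (H.Δ u) (fun x y => sw (H.Δ x) (fun p q => B p q y)) =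
      sw (H.Δ u) (fun x y => sw (H.Δ y) (B x)) := by
  rw [← lift₃_comulTensor h12 h23, H.coassoc]
  exact lift₃_idTensor h12 h23 H.Δ H.Δ_s _

theorem sw_Δ_s {B : U → U → P} (h : Bal H.rt H.ls B) (a : A) (u : U) :
    sw (H.Δ (H.s a * u)) B = sw (H.Δ u) (fun x y => B (H.s a * x) y) := by
  rw [H.Δ_s]
  exact h.sw_apply _ (fun x => H.s a * x) (fun y => y) (by simp) _

theorem sw_Δ_t {B : U → U → P} (h : Bal H.rt H.ls B) (a : A) (u : U) :
    sw (H.Δ (H.t (op a) * u)) B = sw (H.Δ u) (fun x y => B x (H.t (op a) * y)) := by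
  rw [H.Δ_t]
  exact h.sw_apply _ (fun x => x) (fun y => H.t (op a) * y) (by simp) _

theorem sw_Δ_mul_t {B : U → U → P} (h : Bal H.rt H.ls B) (a : A) (u : U) :
    sw (H.Δ (u * H.t (op a))) B = sw (H.Δ u) (fun x y => B x (y * H.t (op a))) := by
  rw [H.Δ_mul_t]
  exact h.sw_apply _ (fun x => x) (fun y => y * H.t (op a)) (by simp) _

theorem sw_takeuchi {B : U → U → P} (h : Bal H.rt H.ls B) (a : A) (u : U) :
    sw (H.Δ u) (fun x y => B (x * H.t (op a)) y) = sw (H.Δ u) (fun x y => B x (y * H.s a)) := by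
  rw [← h.sw_apply (H.fstMulRight _ (H.t (op a))) (fun x => x * H.t (op a)) (fun y => y) (by simp),
    H.takeuchi]
  exact h.sw_apply _ (fun x => x) (fun y => y * H.s a) (by simp) _

theorem sw_Δ_one {B : U → U → P} (h : Bal H.rt H.ls B) : sw (H.Δ 1) B = B 1 1 := by
  rw [H.Δ_one, h.sw_mk]

theorem Δ_mul_eq_sw (u v : U) : H.Δ (u * v) = sw (H.Δ u) (fun x y => sw (H.Δ v)
    (fun p q => BalTensor.mk H.rt H.ls (x * p) (y * q))) := by
  have h1 := (exists_eq_sum_mk (H.Δ u)).choose_spec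
  have h2 := (exists_eq_sum_mk (H.Δ v)).choose_spec
  set S := (exists_eq_sum_mk (H.Δ u)).choose with hS
  set T := (exists_eq_sum_mk (H.Δ v)).choose with hT
  -- The axiom admits any representatives, so it is applied to the very ones that `sw` has chosen.
  -- The summand $xp\otimes yq$ then need not be balanced in either pair separately.
  rw [H.Δ_mul u v (∑ p ∈ S, p.1 ⊗ₜ p.2) (∑ p ∈ T, p.1 ⊗ₜ p.2)]
  · rw [Finset.sum_mul_sum]
    simp only [Algebra.TensorProduct.tmul_mul_tmul]
    change (balRel _ _).mkQ _ = _
    simp only [map_sum, sw, ← hS, ← hT]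
    rfl
  · rw [h1]
    exact map_sum (balRel _ _).mkQ _ _
  · rw [h2]
    exact map_sum (balRel _ _).mkQ _ _

theorem sw_Δ_mul {B : U → U → P} (h : Bal H.rt H.ls B) (u v : U) :
    sw (H.Δ (u * v)) B =
      sw (H.Δ u) (fun x y => sw (H.Δ v) (fun p q => B (x * p) (y * q))) := by
  rw [h.sw_eq, Δ_mul_eq_sw, map_sw]
  simp only [map_sw, h.lift_mk]

theorem sw_counit_left (u : U) : sw (H.Δ u) (fun x y => H.s (H.ε x) * y) = u := by
  conv_rhs => rw [← H.counit_left u, ← sw_eq_apply]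
  refine sw_congr _ fun x y => ?_
  simp only [AeRing.pair]
  rfl

theorem sw_counit_right (u : U) : sw (H.Δ u) (fun x y => H.t (op (H.ε y)) * x) = u := by
  conv_rhs => rw [← H.counit_right u, ← sw_eq_apply]
  refine sw_congr _ fun x y => ?_
  simp only [AeRing.pairRight, BalTensor.lift_mk]
  rfl

end LeftBialgebroid

/-! ### The action $\rightharpoonup$ and its characterisation by the Galois map. -/

namespace LeftBialgebroid

open BalTensor

variable {k A U : Type*} [CommRing k] [Ring A] [Algebra k A] [Ring U] [Algebra k U]
variable {H : LeftBialgebroid k A U}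
variable {M : Type*} [AddCommGroup M] [Module k M]

theorem _root_.BalTensor.Bal.mulRight {P : Type*} [AddCommGroup P] [Module k P] {B : U → U → P}
    (h : Bal H.rt H.ls B) (v : U) : Bal H.rt H.ls (fun x y => B x (y * v)) where
  left n := h.left _
  right m := ⟨fun x y => by simp [add_mul, (h.right m).map_add],
    fun c x => by simp [(h.right m).map_smul]⟩
  bal a m n := by simpa [mul_assoc] using h.bal a m (n * v)

/-- `u₁₊ ⊗ u₁₋ u₂ = u ⊗ 1`. -/
theorem sw_translation (hH : H.IsLeftHopf) (u : U) :
    sw (H.Δ u) (fun x y => opR y (translation hH x)) = BalTensor.mk _ _ u 1 := by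
  -- The Galois map sends both sides to $\Delta(u)$.
  apply hH.1
  rw [map_sw, galois_mk]
  conv_rhs => rw [← sw_eq_apply]
  refine sw_congr _ fun x y => ?_
  rw [galois_opR, galois_translation]
  simp

section Adjoint

variable (hH : H.IsLeftHopf) (act : U →ₐ[k] Module.End k M) (ρ : Aᵐᵒᵖ →ₐ[k] Module.End k M)
variable (h : ∀ a, act (H.t a) = ρ a)

theorem adjAux_opR (f : H.HomA ρ) (z : H.UUop) (x w : U) :
    adjAux act ρ h f (opR x z) w = adjAux act ρ h f z (x * w) := by
  have : (adjAux act ρ h f).flip w ∘ₗ opR x = (adjAux act ρ h f).flip (x * w) := by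
    apply hom_ext
    intro p q
    simp [mul_assoc]
  exact LinearMap.congr_fun this z

theorem adjAux_opL (f : H.HomA ρ) (z : H.UUop) (x w : U) :
    adjAux act ρ h f (opL x z) w = act x (adjAux act ρ h f z w) := by
  have : (adjAux act ρ h f).flip w ∘ₗ opL x = act x ∘ₗ (adjAux act ρ h f).flip w := by
    apply hom_ext
    intro p q
    simp
  exact LinearMap.congr_fun this z

/-- `(t(a) u) ⇀ f = (u ⇀ f)(s(a) -)`. -/
theorem adj_t_mul (f : H.HomA ρ) (a : A) (u w : U) :
    (adj hH act ρ h f (H.t (op a) * u)) w = (adj hH act ρ h f u) (H.s a * w) := by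
  rw [adj_apply, adj_apply, translation_t_mul, adjAux_opR]

/-- `((s(a) u) ⇀ f)(w) = s(a) (u ⇀ f)(w)`. -/
theorem adj_s_mul (f : H.HomA ρ) (a : A) (u w : U) :
    (adj hH act ρ h f (H.s a * u)) w = act (H.s a) ((adj hH act ρ h f u) w) := by
  rw [adj_apply, adj_apply, translation_s_mul, adjAux_opL]

theorem bal_adj (f : H.HomA ρ) :
    Bal H.rt H.ls (fun x y => (adj hH act ρ h f x) y) where
  left y := ⟨fun _ _ => by simp, fun _ _ => by simp⟩
  right x := ⟨fun _ _ => by simp, fun _ _ => by simp⟩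
  bal a x y := adj_t_mul hH act ρ h f a x y

/-- `(u₁ ⇀ f)(u₂ v) = u f(v)`. -/
theorem sw_adj (f : H.HomA ρ) (u v : U) :
    sw (H.Δ u) (fun x y => (adj hH act ρ h f x) (y * v)) = act u (f v) := by
  have : act u (f v) = (adjAux act ρ h f).flip v (BalTensor.mk _ _ u 1) := by simp
  rw [this, ← sw_translation hH, map_sw]
  refine sw_congr _ fun x y => ?_
  rw [LinearMap.flip_apply, adjAux_opR, adj_apply]

/-- `u ⇀ f` is characterised by `(u₁ ⇀ f)(u₂ v) = u f(v)`. -/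
theorem adj_unique (f : H.HomA ρ) {F : U → U → M} (hF : Bal H.rt H.ls F)
    (hev : ∀ u v, sw (H.Δ u) (fun x y => F x (y * v)) = act u (f v)) (u v : U) :
    (adj hH act ρ h f u) v = F u v := by
  -- On $x\otimes y$ the right side is $\sum F(x_1,x_2yv)$, which is $x f(yv)$ by hypothesis. At
  -- $u_+\otimes u_-$, which the Galois map sends to $u\otimes1$, the equality becomes the claim.
  have key : (adjAux act ρ h f).flip v = (hF.mulRight v).lift ∘ₗ H.galois := by
    apply hom_ext
    intro x y
    rw [LinearMap.comp_apply, galois_mk, ← Bal.sw_eq,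
      (hF.mulRight v).sw_apply (H.sndMulRight y) (fun p => p) (fun q => q * y) (by simp)]
    simp only [mul_assoc, hev]
    simp
  have := LinearMap.congr_fun key (translation hH u)
  rw [LinearMap.comp_apply, galois_translation] at this
  simpa [adj_apply] using this

theorem adj_one (f : H.HomA ρ) : adj hH act ρ h f 1 = f := by
  apply Subtype.ext
  ext v
  have := sw_adj hH act ρ h f 1 v
  rw [sw_Δ_one H ((bal_adj hH act ρ h f).mulRight v)] at this
  simpa using this

theorem adj_t (f : H.HomA ρ) (a : A) : adj hH act ρ h f (H.t (op a)) = H.homRact ρ (op a) f := by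
  apply Subtype.ext
  ext v
  have := adj_t_mul hH act ρ h f a 1 v
  rwa [mul_one, adj_one] at this

/-- By uniqueness it suffices that $\sum(x_1v\rightharpoonup f)(x_2w)=x\,(v\rightharpoonup f)(w)$.
This is the value at $v_+\otimes v_-$ of an identity of linear maps in $p\otimes q$ that expresses
`sw_adj` for the product $xp$. -/
theorem adj_mul (f : H.HomA ρ) (u v : U) :
    adj hH act ρ h f (u * v) = adj hH act ρ h (adj hH act ρ h f v) u := by
  apply Subtype.ext
  ext w
  symm
  refine adj_unique hH act ρ h (adj hH act ρ h f v)
    (F := fun x y => (adj hH act ρ h f (x * v)) y) ?_ ?_ u w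
  · constructor
    · exact fun _ => ⟨fun _ _ => by simp [add_mul], fun _ _ => by simp⟩
    · exact fun _ => ⟨fun _ _ => by simp, fun _ _ => by simp⟩
    · intro a x y
      simpa [mul_assoc] using adj_t_mul hH act ρ h f a (x * v) y
  · intro x w
    have hb := (bal_adj hH act ρ h f).mulRight w
    -- Balancedness in `p`, `q` is the Takeuchi property of $\Delta(x)$: a factor $t(a)$ to the
    -- right of $x_1$ becomes $s(a)$ to the right of $x_2$.
    have hB : Bal H.rt H.ls (fun p q => sw (H.Δ x) (fun c d =>
        (adj hH act ρ h f (c * p)) (d * (q * w)))) := by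
      constructor
      · exact fun _ => ⟨fun _ _ => by simp [mul_add, sw, Finset.sum_add_distrib],
          fun _ _ => by simp [sw, Finset.smul_sum]⟩
      · exact fun _ => ⟨fun _ _ => by simp [mul_add, add_mul, sw, Finset.sum_add_distrib],
          fun _ _ => by simp [sw, Finset.smul_sum]⟩
      · intro a p q
        have hc : Bal H.rt H.ls (fun c d => (adj hH act ρ h f (c * p)) (d * (q * w))) := by
          constructor
          · exact fun _ => ⟨fun _ _ => by simp [add_mul], fun _ _ => by simp⟩
          · exact fun _ => ⟨fun _ _ => by simp [add_mul], fun _ _ => by simp⟩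
          · intro a x y
            simpa [mul_assoc] using adj_t_mul hH act ρ h f a (x * p) (y * (q * w))
        have := sw_takeuchi H hc a x
        simpa [mul_assoc] using this
    let L : H.UUop →ₗ[k] M := hB.lift ∘ₗ H.galois
    have hL : L = (act x) ∘ₗ (adjAux act ρ h f).flip w := by
      apply hom_ext
      intro p q
      have e := sw_adj hH act ρ h f (x * p) (q * w)
      rw [sw_Δ_mul H ((bal_adj hH act ρ h f).mulRight (q * w))] at e
      simp only [L, LinearMap.comp_apply, galois_mk, LinearMap.flip_apply, adjAux_mk]
      rw [← Bal.sw_eq, hB.sw_apply (H.sndMulRight q) (fun c => c) (fun d => d * q) (by simp),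
        sw_sw_comm]
      simpa [mul_assoc] using e
    have := LinearMap.congr_fun hL (translation hH v)
    simp only [L, LinearMap.comp_apply, galois_translation, LinearMap.flip_apply] at this
    rw [Bal.lift_mk] at this
    simpa [adj_apply] using this

@[simp]
theorem _root_.AeRing.homMulRight_apply (E : AeRing k A U) (x : U) (f : E.HomA ρ) (w : U) :
    (E.homMulRight ρ x f) w = f (w * x) := rfl

theorem adj_homMulRight (f : H.HomA ρ) (x u : U) :
    adj hH act ρ h (H.homMulRight ρ x f) u = H.homMulRight ρ x (adj hH act ρ h f u) := by
  apply Subtype.ext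
  ext w
  refine adj_unique hH act ρ h _ (F := fun c d => (adj hH act ρ h f c) (d * x))
    ((bal_adj hH act ρ h f).mulRight x) ?_ u w
  intro u v
  simpa [mul_assoc] using sw_adj hH act ρ h f u (v * x)

/-- `adj` is bundled as linear in `u` only; additivity in `f` comes from uniqueness. -/
theorem adj_sum {ι : Type*} (S : Finset ι) (f : ι → H.HomA ρ) (u : U) :
    adj hH act ρ h (∑ i ∈ S, f i) u = ∑ i ∈ S, adj hH act ρ h (f i) u := by
  apply Subtype.ext
  ext w
  refine adj_unique hH act ρ h _ (F := fun c d => (∑ i ∈ S, adj hH act ρ h (f i) c).1 d) ?_ ?_ u w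
  · constructor
    · exact fun _ => ⟨fun _ _ => by simp [Finset.sum_add_distrib], fun _ _ => by simp [Finset.smul_sum]⟩
    · exact fun _ => ⟨fun _ _ => by simp [Finset.sum_add_distrib], fun _ _ => by simp [Finset.smul_sum]⟩
    · intro a x y
      simp [adj_t_mul]
  · intro u v
    have e : ∀ (g : ι → H.HomA ρ) w, (∑ i ∈ S, g i).1 w = ∑ i ∈ S, (g i).1 w := by simp
    simp only [e, map_sum, ← sw_adj hH act ρ h]
    simp only [sw]
    exact Finset.sum_comm

end Adjoint

end LeftBialgebroid

/-! ### Fourfold coassociativity and counit identities. -/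

namespace LeftBialgebroid

open BalTensor

variable {k A U : Type*} [CommRing k] [Ring A] [Algebra k A] [Ring U] [Algebra k U]
variable (H : LeftBialgebroid k A U)
variable {M : Type*} [AddCommGroup M] [Module k M]
variable {P : Type*} [AddCommGroup P] [Module k P]

section FourfoldCoassociativity

variable {G : U → U → U → U → P}

/-- Regroups so that the two middle legs come from one coproduct, where `adjDual_conv` can contract
them. -/
theorem sw_coassoc_outer (h12 : ∀ r s, Bal H.rt H.ls (fun p q => G p q r s))
    (h23 : ∀ p s, Bal H.rt H.ls (fun q r => G p q r s)) (h34 : ∀ p q, Bal H.rt H.ls (G p q))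
    (u : U) :
    sw (H.Δ u) (fun x y => sw (H.Δ x) (fun p q => sw (H.Δ y) (G p q))) =
      sw (H.Δ u) (fun p z => sw (H.Δ z) (fun y s => sw (H.Δ y) (fun q r => G p q r s))) := by
  rw [sw_coassoc H (B := fun p q y => sw (H.Δ y) (G p q))]
  · exact sw_congr _ fun p z => (sw_coassoc H (h23 p) (h34 p) z).symm
  · intro y
    constructor
    · exact fun q => ⟨fun _ _ => by simp [sw, ((h12 _ _).left q).map_add, Finset.sum_add_distrib],
        fun _ _ => by simp [sw, ((h12 _ _).left q).map_smul, Finset.smul_sum]⟩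
    · exact fun p => ⟨fun _ _ => by simp [sw, ((h12 _ _).right p).map_add, Finset.sum_add_distrib],
        fun _ _ => by simp [sw, ((h12 _ _).right p).map_smul, Finset.smul_sum]⟩
    · exact fun a p q => sw_congr _ fun r s => (h12 r s).bal a p q
  · intro p
    constructor
    · exact fun y => ⟨fun _ _ => by
        simp [sw, ((h12 _ _).right p).map_add, Finset.sum_add_distrib],
        fun _ _ => by simp [sw, ((h12 _ _).right p).map_smul, Finset.smul_sum]⟩
    · exact fun q => ⟨fun _ _ => by simp [(h34 p q).sw_add],
        fun _ _ => by simp [(h34 p q).sw_smul]⟩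
    · intro a q y
      rw [AeRing.ls_apply, sw_Δ_s H (h34 p q)]
      exact sw_congr _ fun r s => (h23 p s).bal a q r

/-- Matches the nesting produced by the aYD condition (left) with the one produced by the
Yetter–Drinfel'd condition (right) in `tensorAct_contraMap`. -/
theorem sw_coassoc_inner (h12 : ∀ r s, Bal H.rt H.ls (fun p q => G p q r s))
    (h23 : ∀ p s, Bal H.rt H.ls (fun q r => G p q r s)) (h34 : ∀ p q, Bal H.rt H.ls (G p q))
    (u : U) :
    sw (H.Δ u) (fun x s => sw (H.Δ x) (fun p y => sw (H.Δ y) (fun q r => G p q r s))) =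
      sw (H.Δ u) (fun p z => sw (H.Δ z) (fun q y => sw (H.Δ y) (G p q))) := by
  rw [sw_coassoc H (B := fun p y s => sw (H.Δ y) (fun q r => G p q r s))]
  · exact sw_congr _ fun p z => sw_coassoc H (h23 p) (h34 p) z
  · intro s
    constructor
    · exact fun q => ⟨fun _ _ => by simp [sw, ((h12 _ _).left _).map_add, Finset.sum_add_distrib],
        fun _ _ => by simp [sw, ((h12 _ _).left _).map_smul, Finset.smul_sum]⟩
    · exact fun p => ⟨fun _ _ => by simp [(h23 p s).sw_add],
        fun _ _ => by simp [(h23 p s).sw_smul]⟩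
    · intro a p y
      rw [AeRing.ls_apply, sw_Δ_s H (h23 p s)]
      exact sw_congr _ fun q r => (h12 r s).bal a p q
  · intro p
    constructor
    · exact fun s => ⟨fun _ _ => by simp [(h23 p s).sw_add],
        fun _ _ => by simp [(h23 p s).sw_smul]⟩
    · exact fun y => ⟨fun _ _ => by
        simp [sw, ((h34 _ _).right _).map_add, Finset.sum_add_distrib],
        fun _ _ => by simp [sw, ((h34 _ _).right _).map_smul, Finset.smul_sum]⟩
    · intro a y s
      rw [AeRing.rt_apply, sw_Δ_t H (h23 p s)]
      exact sw_congr _ fun q r => (h34 p q).bal a r s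

end FourfoldCoassociativity

/-- `s(ε(u₁ t(a))) u₂ = u s(a)`. -/
theorem sw_base_left (a : A) (u : U) :
    sw (H.Δ u) (fun x y => H.s (H.baseAct x a) * y) = u * H.s a := by
  have hb : Bal H.rt H.ls (fun x y => H.s (H.ε x) * y) := by
    constructor
    · exact fun _ => ⟨fun _ _ => by simp [add_mul], fun _ _ => by simp⟩
    · exact fun _ => ⟨fun _ _ => by simp [mul_add], fun _ _ => by simp⟩
    · intro a x y
      simp [H.ε_t, mul_assoc]
  -- The Takeuchi property moves $t(a)$ out of the counit, to $s(a)$ at the end of the second leg;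
  -- the counit axiom does the rest.
  have := sw_takeuchi H hb a u
  simp only [baseAct_apply, this, ← mul_assoc]
  conv_rhs => rw [← sw_counit_left H u, ← LinearMap.mulRight_apply (R := k), map_sw]
  rfl

/-- `t(ε(u₂ t(a))) u₁ = u t(a)`. -/
theorem sw_base_right (a : A) (u : U) :
    sw (H.Δ u) (fun x y => H.t (op (H.baseAct y a)) * x) = u * H.t (op a) := by
  have hb : Bal H.rt H.ls (fun x y => H.t (op (H.ε y)) * x) := by
    constructor
    · exact fun _ => ⟨fun _ _ => by simp [mul_add], fun _ _ => by simp⟩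
    · exact fun _ => ⟨fun _ _ => by simp [add_mul], fun _ _ => by simp⟩
    · intro a x y
      simp [H.ε_s, mul_assoc]
  conv_rhs => rw [← sw_counit_right H (u * _), sw_Δ_mul_t H hb]
  rfl

/-! ### The product on $U^*$ and its $U$-module algebra structure. -/

variable {H}

theorem homComul_apply {ρ : Aᵐᵒᵖ →ₐ[k] Module.End k M} (h : H.HomA (H.homRact ρ)) (v : U) :
    (H.homComul h) v = sw (H.Δ v) (fun x y => (h.1 x).1 y) := by
  change H.uncurryHom h (H.Δ v) = _
  rw [← sw_eq_apply]
  exact sw_congr _ fun x y => H.uncurryHom_mk h x y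

/-- The product `(ψ φ)(v) = ψ(s(φ(v₁)) v₂)` on `U^*`. -/
def conv (ψ φ : H.Dual) : H.Dual :=
  H.homComul (H.rankOne (H.homRact (AeRing.regR k A)) ψ φ)

theorem conv_apply (ψ φ : H.Dual) (v : U) :
    (conv ψ φ) v = sw (H.Δ v) (fun x y => ψ (H.s (φ x) * y)) :=
  homComul_apply _ v

theorem bal_conv_apply (ψ φ : H.Dual) : Bal H.rt H.ls (fun x y => ψ (H.s (φ x) * y)) where
  left _ := ⟨fun _ _ => by simp [add_mul], fun _ _ => by simp⟩
  right _ := ⟨fun _ _ => by simp [mul_add], fun _ _ => by simp⟩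
  bal a x y := by
    have := φ.2 (op a) x
    simp only [AeRing.rt_apply, AeRing.ls_apply, this, AeRing.regR_apply, map_mul, mul_assoc,
      unop_op]

variable (hH : H.IsLeftHopf)

theorem sw_adjDual (φ : H.Dual) (u v : U) :
    sw (H.Δ u) (fun x y => (adjDual hH φ x) (y * v)) = H.baseAct u (φ v) :=
  sw_adj hH H.baseAct _ H.baseAct_t φ u v

theorem adjDual_unique (φ : H.Dual) {F : U → U → A} (hF : Bal H.rt H.ls F)
    (hev : ∀ u v, sw (H.Δ u) (fun x y => F x (y * v)) = H.baseAct u (φ v)) (u v : U) :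
    (adjDual hH φ u) v = F u v :=
  adj_unique hH H.baseAct _ H.baseAct_t φ hF hev u v

theorem adjDual_mul (φ : H.Dual) (u v : U) :
    adjDual hH φ (u * v) = adjDual hH (adjDual hH φ v) u :=
  adj_mul hH H.baseAct _ H.baseAct_t φ u v

theorem adjDual_one (φ : H.Dual) : adjDual hH φ 1 = φ :=
  adj_one hH H.baseAct _ H.baseAct_t φ

theorem adjDual_t (φ : H.Dual) (a : A) : adjDual hH φ (H.t (op a)) = H.homRact _ (op a) φ :=
  adj_t hH H.baseAct _ H.baseAct_t φ a

theorem adjDual_s_apply (φ : H.Dual) (a : A) (w : U) : (adjDual hH φ (H.s a)) w = a * φ w := by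
  have := adjDual_s_mul hH φ a 1 w
  rwa [mul_one, adjDual_one] at this

theorem adjDual_homMulRight (φ : H.Dual) (x u : U) :
    adjDual hH (H.homMulRight _ x φ) u = H.homMulRight _ x (adjDual hH φ u) :=
  adj_homMulRight hH H.baseAct _ H.baseAct_t φ x u

/-- `u ⇀ ε = ε(u) ε`. -/
theorem adjDual_counit_apply (u v : U) : (adjDual hH H.counitDual u) v = H.ε u * H.ε v := by
  refine adjDual_unique hH H.counitDual (F := fun x y => H.ε x * H.ε y) ?_ ?_ u v
  · constructor
    · exact fun _ => ⟨fun _ _ => by simp [add_mul], fun _ _ => by simp⟩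
    · exact fun _ => ⟨fun _ _ => by simp [mul_add], fun _ _ => by simp⟩
    · intro a x y
      simp [H.ε_t, H.ε_s, mul_assoc]
  · intro u v
    have : H.baseAct u (H.counitDual v) = H.ε (u * v) := (H.ε_mul_t u v).symm
    rw [this]
    conv_rhs => rw [← sw_counit_left H u, ← LinearMap.mulRight_apply (R := k), map_sw, map_sw]
    refine sw_congr _ fun x y => ?_
    simp [mul_assoc, H.ε_s]

theorem adjDual_sDual_apply (a : A) (u v : U) :
    (adjDual hH (H.sDual a) u) v = H.ε u * (H.sDual a) v := by
  rw [sDual, adjDual_homMulRight]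
  exact adjDual_counit_apply hH u (v * H.s a)

theorem bal_adjDual_conv (ψ φ : H.Dual) :
    Bal H.rt H.ls (fun x y => conv (adjDual hH ψ x) (adjDual hH φ y)) where
  left y := ⟨fun x x' => by
      apply Subtype.ext; ext v
      simp [conv_apply, sw, Finset.sum_add_distrib], fun c x => by
      apply Subtype.ext; ext v
      simp [conv_apply, sw, Finset.smul_sum]⟩
  right x := ⟨fun y y' => by
      apply Subtype.ext; ext v
      simp [conv_apply, sw, add_mul, Finset.sum_add_distrib], fun c y => by
      apply Subtype.ext; ext v
      simp [conv_apply, sw, Finset.smul_sum]⟩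
  bal a x y := by
    apply Subtype.ext; ext v
    rw [conv_apply, conv_apply]
    refine sw_congr _ fun c d => ?_
    rw [AeRing.rt_apply, AeRing.ls_apply, adjDual_t_mul, adjDual_s_mul, AeRing.homRact_apply,
      map_mul H.s, mul_assoc]
    rfl

/-- `U^*` is a module algebra: `u ⇀ (ψ φ) = (u₁ ⇀ ψ) (u₂ ⇀ φ)`. -/
theorem adjDual_conv (ψ φ : H.Dual) (u : U) :
    adjDual hH (conv ψ φ) u = sw (H.Δ u) (fun x y => conv (adjDual hH ψ x) (adjDual hH φ y)) := by
  have hb := bal_adjDual_conv hH ψ φ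
  apply Subtype.ext
  ext v
  refine adjDual_unique hH (conv ψ φ)
    (F := fun u v => (sw (H.Δ u) (fun x y => conv (adjDual hH ψ x) (adjDual hH φ y))).1 v) ?_ ?_ u v
  · constructor
    · exact fun _ => ⟨fun _ _ => by simp [hb.sw_add], fun _ _ => by simp [hb.sw_smul]⟩
    · exact fun _ => ⟨fun _ _ => by simp, fun _ _ => by simp⟩
    · intro a x y
      rw [AeRing.rt_apply, AeRing.ls_apply, sw_Δ_t H hb]
      simp only [sw, AddSubmonoidClass.coe_finsetSum, LinearMap.coe_sum, Finset.sum_apply]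
      refine Finset.sum_congr rfl fun p _ => ?_
      rw [conv_apply, conv_apply, sw_Δ_s H (bal_conv_apply _ _)]
      refine sw_congr _ fun c d => ?_
      rw [adjDual_t_mul]
      rfl
  · intro u v
    -- The sum to compute is
    -- $(u_1\rightharpoonup\psi)\big(s((u_2\rightharpoonup\phi)(u_3v_1))\,u_4v_2\big)$. Contracting
    -- $u_2,u_3$ gives $s(\varepsilon(u_2t(a)))u_3$ with $a=\phi(v_1)$ after renumbering, which is
    -- $u_2s(a)$ by `sw_base_left`. The characterisation of $u\rightharpoonup\psi$ finishes.
    let G : U → U → U → U → A := fun p q r s =>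
      sw (H.Δ v) (fun c d => (adjDual hH ψ p) (H.s ((adjDual hH φ q) (r * c)) * (s * d)))
    have e : ∀ x y, (sw (H.Δ x) (fun p q => conv (adjDual hH ψ p) (adjDual hH φ q))).1 (y * v) =
        sw (H.Δ x) (fun p q => sw (H.Δ y) (G p q)) := by
      intro x y
      simp only [sw, AddSubmonoidClass.coe_finsetSum, LinearMap.coe_sum, Finset.sum_apply]
      refine Finset.sum_congr rfl fun p _ => ?_
      rw [conv_apply, sw_Δ_mul H (bal_conv_apply _ _)]
      rfl
    simp only [e]
    rw [sw_coassoc_outer H]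
    · have e1 : ∀ p y s, sw (H.Δ y) (fun q r => G p q r s) = sw (H.Δ v) (fun c d =>
          (adjDual hH ψ p) (H.s (H.baseAct y (φ c)) * (s * d))) := by
        intro p y s
        rw [sw_sw_comm]
        refine sw_congr _ fun c d => ?_
        rw [← sw_adjDual hH φ y c]
        simp [sw, Finset.sum_mul]
      simp only [e1]
      have e2 : ∀ p z, sw (H.Δ z) (fun y s => sw (H.Δ v) (fun c d =>
          (adjDual hH ψ p) (H.s (H.baseAct y (φ c)) * (s * d)))) =
          sw (H.Δ v) (fun c d => (adjDual hH ψ p) (z * (H.s (φ c) * d))) := by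
        intro p z
        rw [sw_sw_comm]
        refine sw_congr _ fun c d => ?_
        rw [← mul_assoc, ← sw_base_left]
        simp [sw, Finset.sum_mul, mul_assoc]
      simp only [e2]
      rw [sw_sw_comm]
      simp only [sw_adjDual]
      rw [conv_apply, map_sw]
    · intro r s
      constructor
      · exact fun _ => ⟨fun _ _ => by simp [G, sw, Finset.sum_add_distrib],
          fun _ _ => by simp [G, sw, Finset.smul_sum]⟩
      · exact fun _ => ⟨fun _ _ => by simp [G, sw, add_mul, Finset.sum_add_distrib],
          fun _ _ => by simp [G, sw, Finset.smul_sum]⟩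
      · intro a p q
        refine sw_congr _ fun c d => ?_
        rw [AeRing.rt_apply, AeRing.ls_apply, adjDual_t_mul, adjDual_s_mul, AeRing.homRact_apply,
          map_mul H.s, mul_assoc]
        rfl
    · intro p s
      constructor
      · exact fun _ => ⟨fun _ _ => by simp [G, sw, add_mul, Finset.sum_add_distrib],
          fun _ _ => by simp [G, sw, Finset.smul_sum]⟩
      · exact fun _ => ⟨fun _ _ => by simp [G, sw, add_mul, Finset.sum_add_distrib],
          fun _ _ => by simp [G, sw, Finset.smul_sum]⟩
      · intro a q r
        refine sw_congr _ fun c d => ?_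
        rw [AeRing.rt_apply, AeRing.ls_apply, adjDual_t_mul, AeRing.homRact_apply, mul_assoc]
        rfl
    · intro p q
      constructor
      · exact fun _ => ⟨fun _ _ => by simp [G, sw, add_mul, Finset.sum_add_distrib],
          fun _ _ => by simp [G, sw, Finset.smul_sum]⟩
      · exact fun _ => ⟨fun _ _ => by simp [G, sw, add_mul, mul_add, Finset.sum_add_distrib],
          fun _ _ => by simp [G, sw, Finset.smul_sum]⟩
      · intro a r s
        refine sw_congr _ fun c d => ?_
        have := (adjDual hH φ q).2 (op a) (r * c)
        simp only [AeRing.rt_apply, AeRing.ls_apply, mul_assoc, this, AeRing.regR_apply, map_mul,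
          unop_op]

/-! ### Rank one maps under $\rightharpoonup$. -/

section RankOne

variable (act : U →ₐ[k] Module.End k M) (ρ : Aᵐᵒᵖ →ₐ[k] Module.End k M)
variable (h : ∀ a, act (H.t a) = ρ a)

theorem bal_rankOne_adjDual (h : ∀ a, act (H.t a) = ρ a) (m : M) (χ : H.Dual) :
    Bal H.rt H.ls (fun x y => H.rankOne ρ (act x m) (adjDual hH χ y)) where
  left y := ⟨fun x x' => by simp, fun c x => by simp⟩
  right x := ⟨fun y y' => by simp, fun c y => by simp⟩
  bal a x y := by
    apply Subtype.ext; ext w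
    rw [AeRing.rankOne_apply, AeRing.rankOne_apply, AeRing.rt_apply, AeRing.ls_apply,
      adjDual_s_mul, op_mul, map_mul, map_mul, h]
    rfl

/-- `u ⇀ m⟨χ, -⟩ = (u₁ m)⟨u₂ ⇀ χ, -⟩`. -/
theorem adj_rankOne (m : M) (χ : H.Dual) (u : U) :
    adj hH act ρ h (H.rankOne ρ m χ) u =
      sw (H.Δ u) (fun x y => H.rankOne ρ (act x m) (adjDual hH χ y)) := by
  have hb := bal_rankOne_adjDual hH act ρ h m χ
  apply Subtype.ext
  ext v
  refine adj_unique hH act ρ h (H.rankOne ρ m χ)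
    (F := fun u v => (sw (H.Δ u) (fun x y => H.rankOne ρ (act x m) (adjDual hH χ y))).1 v)
    ?_ ?_ u v
  · constructor
    · exact fun _ => ⟨fun _ _ => by simp [hb.sw_add], fun _ _ => by simp [hb.sw_smul]⟩
    · exact fun _ => ⟨fun _ _ => by simp, fun _ _ => by simp⟩
    · intro a x y
      rw [AeRing.rt_apply, AeRing.ls_apply, sw_Δ_t H hb]
      simp only [sw, AddSubmonoidClass.coe_finsetSum, LinearMap.coe_sum, Finset.sum_apply]
      refine Finset.sum_congr rfl fun p _ => ?_
      rw [adjDual_t_mul]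
      rfl
  · intro u v
    have e : ∀ x y, (sw (H.Δ x) (fun p q => H.rankOne ρ (act p m) (adjDual hH χ q))).1 (y * v) =
        sw (H.Δ x) (fun p q => act (H.t (op ((adjDual hH χ q) (y * v))) * p) m) := by
      intro x y
      simp only [sw, AddSubmonoidClass.coe_finsetSum, LinearMap.coe_sum, Finset.sum_apply]
      refine Finset.sum_congr rfl fun p _ => ?_
      rw [AeRing.rankOne_apply, map_mul act, h]
      rfl
    simp only [e]
    -- Once $u_2,u_3$ are legs of one coproduct, $(u_2\rightharpoonup\chi)(u_3v)$ contracts to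
    -- $\varepsilon(u_2t(\chi(v)))$, and `sw_base_right` absorbs this into $u\,t(\chi(v))$.
    rw [sw_coassoc H (B := fun p q y => act (H.t (op ((adjDual hH χ q) (y * v))) * p) m)]
    · have e1 : ∀ p z, sw (H.Δ z) (fun q y => act (H.t (op ((adjDual hH χ q) (y * v))) * p) m) =
          act (H.t (op (H.baseAct z (χ v))) * p) m := by
        intro p z
        rw [← sw_adjDual hH χ z v]
        simp [sw, Finset.sum_mul]
      simp only [e1]
      rw [AeRing.rankOne_apply, ← h, ← Module.End.mul_apply, ← map_mul, ← sw_base_right]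
      simp [sw]
    · intro y
      constructor
      · exact fun _ => ⟨fun _ _ => by simp, fun _ _ => by simp⟩
      · exact fun _ => ⟨fun _ _ => by simp, fun _ _ => by simp⟩
      · intro a p q
        rw [AeRing.rt_apply, AeRing.ls_apply, adjDual_s_mul, op_mul, map_mul H.t, mul_assoc]
    · intro p
      constructor
      · exact fun _ => ⟨fun _ _ => by simp, fun _ _ => by simp⟩
      · exact fun _ => ⟨fun _ _ => by simp [add_mul], fun _ _ => by simp⟩
      · intro a q y
        rw [AeRing.rt_apply, AeRing.ls_apply, adjDual_t_mul, mul_assoc]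
        rfl

end RankOne

end LeftBialgebroid

/-! ### Contramodules and comodules in Sweedler form. -/

section Coefficients

open BalTensor

variable {k A U : Type*} [CommRing k] [Ring A] [Algebra k A] [Ring U] [Algebra k U]
variable {H : LeftBialgebroid k A U}
variable {M : Type*} [AddCommGroup M] [Module k M] {N : Type*} [AddCommGroup N] [Module k N]
variable {P : Type*} [AddCommGroup P] [Module k P]

namespace LeftBialgebroid

/-- Follows from $\varepsilon(t(a))=a$. It reconciles the $A$-actions on (contra)comodules, defined
through $s$, with the $U$-action on $A$, defined through $t$. -/
theorem ε_mul_s_eq_baseAct (u : U) (a : A) : H.ε (u * H.s a) = H.baseAct u a := by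
  have := H.ε_t (op a) 1
  rw [mul_one, H.ε_one, one_mul, unop_op] at this
  rw [baseAct_apply, H.ε_mul_s u (H.t (op a)), this]

/-- `ε(u s(a)) = ε(u t(a))`. -/
theorem sDual_eq_baseAct (a : A) (u : U) : (H.sDual a) u = H.baseAct u a :=
  ε_mul_s_eq_baseAct u a

end LeftBialgebroid

namespace RightContramodule

variable (C : RightContramodule H M)

/-- `γ(γ(m⟨ψ, -⟩)⟨φ, -⟩) = γ(m⟨ψ φ, -⟩)`. -/
theorem γ_conv (ψ φ : H.Dual) (m : M) :
    C.γ (H.rankOne C.ract (C.γ (H.rankOne C.ract m ψ)) φ) =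
      C.γ (H.rankOne C.ract m (LeftBialgebroid.conv ψ φ)) := by
  -- Contraassociativity for a rank one map whose coefficient is itself of rank one.
  have := C.γ_assoc (H.rankOne (H.homRact C.ract) (H.rankOne C.ract m ψ) φ)
  have e1 : H.homPost C.γ C.γ_ract (H.rankOne (H.homRact C.ract) (H.rankOne C.ract m ψ) φ) =
      H.rankOne C.ract (C.γ (H.rankOne C.ract m ψ)) φ := by
    apply Subtype.ext
    ext v
    exact C.γ_ract _ _
  have e2 : H.homComul (H.rankOne (H.homRact C.ract) (H.rankOne C.ract m ψ) φ) =
      H.rankOne C.ract m (LeftBialgebroid.conv ψ φ) := by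
    apply Subtype.ext
    ext v
    rw [LeftBialgebroid.homComul_apply, AeRing.rankOne_apply, LeftBialgebroid.conv_apply]
    simp [sw]
  rwa [e1, e2] at this

/-- `γ(a f(-)) = γ(f((-) t(a)))`. -/
theorem γ_lact (a : A) (g g' : H.HomA C.ract) (hg : ∀ u, g' u = C.lact a (g u)) :
    C.γ g' = C.γ (H.homMulRight C.ract (H.t (op a)) g) := by
  -- Contraassociativity is applied to $h(u)=g(u)\langle\varepsilon((-)s(a)),-\rangle$: $\gamma\circ
  -- h$ is $a\,g(-)$, while $h(u_1)(u_2)=g\big(t(\varepsilon(u_2t(a)))u_1\big)=g(u\,t(a))$.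
  let h : H.HomA (H.homRact C.ract) := ⟨((H.rankOne C.ract).flip (H.sDual a)).comp g.1, by
    intro b u
    apply Subtype.ext
    ext v
    have e : H.ε (H.s b.unop * v * H.s a) = b.unop * H.ε (v * H.s a) := by
      rw [mul_assoc, H.ε_s]
    have e' : g.1 (H.t b * u) = C.ract b (g.1 u) := g.2 b u
    change C.ract (op (H.ε (v * H.s a))) (g.1 (H.t b * u)) =
      C.ract (op (H.ε (H.s b.unop * v * H.s a))) (g.1 u)
    rw [e, e', op_mul, map_mul C.ract]
    rfl⟩
  have := C.γ_assoc h
  have e1 : H.homPost C.γ C.γ_ract h = g' := by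
    apply Subtype.ext
    ext v
    exact (hg v).symm
  have e2 : H.homComul h = H.homMulRight C.ract (H.t (op a)) g := by
    apply Subtype.ext
    ext v
    rw [LeftBialgebroid.homComul_apply, AeRing.homMulRight_apply,
      ← LeftBialgebroid.sw_base_right, map_sw]
    refine sw_congr _ fun x y => ?_
    rw [← LeftBialgebroid.sDual_eq_baseAct]
    exact (g.2 _ _).symm
  rwa [e1, e2] at this

end RightContramodule

namespace LeftComodule

variable (D : LeftComodule H N)

theorem sw_coassoc {B : U → U → N → P} (h12 : ∀ n, Bal H.rt H.ls (fun u v => B u v n))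
    (h23 : ∀ u, Bal H.rt D.lact (B u)) (n : N) :
    sw (D.coact n) (fun u n' => sw (H.Δ u) (fun p q => B p q n')) =
      sw (D.coact n) (fun u n' => sw (D.coact n') (B u)) := by
  rw [← LeftBialgebroid.lift₃_comulTensor h12 h23, D.coassoc]
  exact LeftBialgebroid.lift₃_idTensor h12 h23 D.coact D.coact_lact _

theorem sw_coact_lact {B : U → N → P} (h : Bal H.rt D.lact B) (a : A) (n : N) :
    sw (D.coact (D.lact a n)) B = sw (D.coact n) (fun u n' => B (H.s a * u) n') := by
  rw [D.coact_lact]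
  exact h.sw_apply _ (fun x => H.s a * x) (fun y => y) (by simp) _

theorem sw_counit (n : N) : sw (D.coact n) (fun u n' => D.lact (H.ε u) n') = n := by
  conv_rhs => rw [← D.counit n, ← sw_eq_apply]
  exact sw_congr _ fun u n' => rfl

theorem ract_apply (a : A) (n : N) :
    D.ract a n = sw (D.coact n) (fun u n' => D.lact (H.baseAct u a) n') := by
  rw [ract, LinearMap.comp_apply, ← sw_eq_apply]
  refine sw_congr _ fun u n' => ?_
  rw [← LeftBialgebroid.sDual_eq_baseAct]
  rfl

/-- `(n a)₋₁ ⊗ (n a)₀ = n₋₁ s(a) ⊗ n₀`. -/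
theorem sw_coact_ract {B : U → N → P} (h : Bal H.rt D.lact B) (a : A) (n : N) :
    sw (D.coact (D.ract a n)) B = sw (D.coact n) (fun u n' => B (u * H.s a) n') := by
  rw [h.sw_eq, ract_apply, map_sw, map_sw]
  simp only [← h.sw_eq, D.sw_coact_lact h]
  -- Coassociativity makes the counit act on the first leg of $\Delta(n_{-1})$, where `sw_base_left`
  -- applies.
  rw [← D.sw_coassoc (B := fun p q n' => B (H.s (H.baseAct p a) * q) n')]
  · refine sw_congr _ fun u n' => ?_
    rw [← LeftBialgebroid.sw_base_left]
    let L : U →ₗ[k] P := ⟨⟨fun x => B x n', (h.left n').map_add⟩, (h.left n').map_smul⟩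
    exact (map_sw L _ _).symm
  · intro n
    constructor
    · exact fun _ => ⟨fun _ _ => by simp [add_mul, (h.left _).map_add],
        fun _ _ => by simp [(h.left _).map_smul]⟩
    · exact fun _ => ⟨fun _ _ => by simp [mul_add, (h.left _).map_add],
        fun _ _ => by simp [(h.left _).map_smul]⟩
    · intro b p q
      rw [AeRing.rt_apply, AeRing.ls_apply, ← mul_assoc, ← map_mul, map_mul H.baseAct,
        H.baseAct_t]
      rfl
  · intro p
    constructor
    · exact fun _ => ⟨fun _ _ => by simp [mul_add, (h.left _).map_add],
        fun _ _ => by simp [(h.left _).map_smul]⟩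
    · exact fun _ => ⟨fun _ _ => by simp [(h.right _).map_add],
        fun _ _ => by simp [(h.right _).map_smul]⟩
    · intro b q n
      rw [← h.bal, AeRing.rt_apply, AeRing.rt_apply, ← mul_assoc, H.s_t_comm, mul_assoc]

/-- `n₋₁ ⊗ n₀ a = n₋₁ t(a) ⊗ n₀`. -/
theorem sw_takeuchi {B : U → N → P} (h : Bal H.rt D.lact B) (a : A) (n : N) :
    sw (D.coact n) (fun u n' => B u (D.ract a n')) =
      sw (D.coact n) (fun u n' => B (u * H.t (op a)) n') := by
  have e : ∀ u n', B u (D.ract a n') =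
      sw (D.coact n') (fun v n'' => B (H.t (op (H.baseAct v a)) * u) n'') := by
    intro u n'
    let L : N →ₗ[k] P := ⟨⟨fun x => B u x, (h.right u).map_add⟩, (h.right u).map_smul⟩
    rw [ract_apply]
    refine (map_sw L _ _).trans (sw_congr _ fun v n'' => ?_)
    exact (h.bal _ _ _).symm
  simp only [e]
  -- Here the counit falls on the second leg of $\Delta(n_{-1})$, so `sw_base_right` applies.
  rw [← D.sw_coassoc (B := fun p q n' => B (H.t (op (H.baseAct q a)) * p) n')]
  · refine sw_congr _ fun u n' => ?_
    rw [← LeftBialgebroid.sw_base_right]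
    let L : U →ₗ[k] P := ⟨⟨fun x => B x n', (h.left n').map_add⟩, (h.left n').map_smul⟩
    exact (map_sw L _ _).symm
  · intro n
    constructor
    · exact fun _ => ⟨fun _ _ => by simp [mul_add, (h.left _).map_add],
        fun _ _ => by simp [(h.left _).map_smul]⟩
    · exact fun _ => ⟨fun _ _ => by simp [add_mul, (h.left _).map_add],
        fun _ _ => by simp [(h.left _).map_smul]⟩
    · intro b p q
      rw [AeRing.rt_apply, AeRing.ls_apply, ← mul_assoc, ← map_mul, ← op_mul,
        LeftBialgebroid.baseAct_apply, LeftBialgebroid.baseAct_apply, mul_assoc, H.ε_s]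
  · intro p
    constructor
    · exact fun _ => ⟨fun _ _ => by simp [add_mul, (h.left _).map_add],
        fun _ _ => by simp [(h.left _).map_smul]⟩
    · exact fun _ => ⟨fun _ _ => by simp [(h.right _).map_add],
        fun _ _ => by simp [(h.right _).map_smul]⟩
    · intro b q n
      rw [← h.bal, AeRing.rt_apply, AeRing.rt_apply, map_mul H.baseAct, H.baseAct_t,
        Module.End.mul_apply, AeRing.regR_apply, op_mul, map_mul H.t, mul_assoc]
      rfl

theorem bal_lact_baseAct (a : A) : Bal H.rt D.lact (fun u n => D.lact (H.baseAct u a) n) := by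
  constructor
  · exact fun _ => ⟨fun _ _ => by simp, fun _ _ => by simp⟩
  · exact fun _ => ⟨fun _ _ => by simp, fun _ _ => by simp⟩
  · intro b u n
    rw [AeRing.rt_apply, map_mul H.baseAct, H.baseAct_t, Module.End.mul_apply, AeRing.regR_apply,
      map_mul]
    rfl

theorem ract_lact (a b : A) (n : N) : D.ract a (D.lact b n) = D.lact b (D.ract a n) := by
  rw [ract_apply, ract_apply, D.sw_coact_lact (D.bal_lact_baseAct a), map_sw]
  refine sw_congr _ fun u n' => ?_
  rw [LeftBialgebroid.baseAct_apply, LeftBialgebroid.baseAct_apply, mul_assoc, H.ε_s, map_mul]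
  rfl

theorem ract_one (n : N) : D.ract 1 n = n := by
  conv_rhs => rw [← D.sw_counit n]
  rw [ract_apply]
  refine sw_congr _ fun u n' => ?_
  simp

theorem ract_mul (a b : A) (n : N) : D.ract (a * b) n = D.ract b (D.ract a n) := by
  rw [ract_apply, ract_apply, D.sw_coact_ract (D.bal_lact_baseAct b)]
  refine sw_congr _ fun u n' => ?_
  rw [← LeftBialgebroid.ε_mul_s_eq_baseAct, ← LeftBialgebroid.ε_mul_s_eq_baseAct, map_mul H.s,
    mul_assoc]

theorem ract_add (a b : A) (n : N) : D.ract (a + b) n = D.ract a n + D.ract b n := by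
  simp [ract_apply, sw, mul_add, Finset.sum_add_distrib]

theorem ract_smul (c : k) (a : A) (n : N) : D.ract (c • a) n = c • D.ract a n := by
  simp [ract_apply, sw, Finset.smul_sum]

end LeftComodule

/-! ### The right $A$-action on $M\otimes_AN$ and the operation $z\cdot\phi$. -/

namespace RightContramodule

variable (C : RightContramodule H M) (D : LeftComodule H N)

theorem tensor_hom_ext {f g : C.tensor D →ₗ[k] P}
    (h : ∀ m n, f (C.tmul D m n) = g (C.tmul D m n)) : f = g :=
  hom_ext h

/-- The right `A`-action `(m ⊗ n) a = m ⊗ n a` on `M ⊗_A N`. -/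
def tensorRact : Aᵐᵒᵖ →ₐ[k] Module.End k (C.tensor D) :=
  AlgHom.ofLinearMap
    { toFun := fun a => BalTensor.map LinearMap.id (D.ract a.unop) (fun _ _ => rfl)
        (fun b n => D.ract_lact a.unop b n)
      map_add' := fun a b => by
        apply hom_ext
        intro m n
        simp [LeftComodule.ract_add]
      map_smul' := fun c a => by
        apply hom_ext
        intro m n
        simp [LeftComodule.ract_smul] }
    (by
      apply hom_ext
      intro m n
      simp [LeftComodule.ract_one])
    (by
      intro a b
      apply hom_ext
      intro m n
      simp [LeftComodule.ract_mul])

theorem tensorRact_tmul (a : A) (m : M) (n : N) :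
    C.tensorRact D (op a) (C.tmul D m n) = C.tmul D m (D.ract a n) :=
  BalTensor.map_mk (ρ := fun a => C.ract (op a)) (ρ' := fun a => C.ract (op a))
    LinearMap.id (D.ract a) (fun _ _ => rfl) (fun b n => D.ract_lact a b n) m n

variable (hH : H.IsLeftHopf)

theorem bal_contra (φ : H.Dual) (m : M) : Bal H.rt D.lact
    (fun u n => C.tmul D (C.γ (H.rankOne C.ract m (LeftBialgebroid.adjDual hH φ u))) n) := by
  constructor
  · exact fun _ => ⟨fun _ _ => by simp, fun _ _ => by simp⟩
  · exact fun _ => ⟨fun _ _ => by simp, fun _ _ => by simp⟩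
  · intro a u n
    rw [← tmul_rel, AeRing.rt_apply, LeftBialgebroid.adjDual_t_mul, ← C.γ_ract]
    rfl

theorem contraMap_tmul (φ : H.Dual) (m : M) (n : N) :
    C.contraMap hH D φ (C.tmul D m n) = sw (D.coact n) (fun u n' =>
      C.tmul D (C.γ (H.rankOne C.ract m (LeftBialgebroid.adjDual hH φ u))) n') := by
  have : C.contraMap hH D φ (C.tmul D m n) = (C.contraAux hH D φ).flip m (D.coact n) :=
    BalTensor.lift_mk _ _ m n
  rw [this, (C.bal_contra D hH φ m).sw_eq]
  refine LinearMap.congr_fun (hom_ext fun u n' => ?_) _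
  rw [Bal.lift_mk, LinearMap.flip_apply, contraAux, BalTensor.lift_mk]
  rfl

theorem contraMap_sum {ι : Type*} (S : Finset ι) (φ : ι → H.Dual) (z : C.tensor D) :
    C.contraMap hH D (∑ i ∈ S, φ i) z = ∑ i ∈ S, C.contraMap hH D (φ i) z := by
  have : C.contraMap hH D (∑ i ∈ S, φ i) = ∑ i ∈ S, C.contraMap hH D (φ i) := by
    apply C.tensor_hom_ext D
    intro m n
    have e : ∀ u, LeftBialgebroid.adjDual hH (∑ i ∈ S, φ i) u =
        ∑ i ∈ S, LeftBialgebroid.adjDual hH (φ i) u :=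
      LeftBialgebroid.adj_sum hH H.baseAct _ H.baseAct_t S φ
    simp only [LinearMap.sum_apply, contraMap_tmul, e, map_sum, LinearMap.sum_apply]
    exact Finset.sum_comm
  rw [this, LinearMap.sum_apply]

/-- Since $(na)_{-1}=n_{-1}s(a)$ and $\rightharpoonup$ is an action. As
$s(a)\rightharpoonup\phi=a\phi$, this says that $z\cdot\phi$ is balanced over $A$. -/
theorem contraMap_ract (φ : H.Dual) (a : A) (z : C.tensor D) :
    C.contraMap hH D φ (C.tensorRact D (op a) z) =
      C.contraMap hH D (LeftBialgebroid.adjDual hH φ (H.s a)) z := by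
  rw [← LinearMap.comp_apply]
  refine LinearMap.congr_fun (C.tensor_hom_ext D fun m n => ?_) z
  rw [LinearMap.comp_apply, tensorRact_tmul, contraMap_tmul, contraMap_tmul,
    D.sw_coact_ract (C.bal_contra D hH φ m)]
  refine sw_congr _ fun u n' => ?_
  rw [LeftBialgebroid.adjDual_mul]

/-- The action on $n_0$ turns into $t(a)$ to the right of $n_{-1}$, and
$t(a)\rightharpoonup\phi=\phi(s(a)\,-)$. This yields right $A$-linearity of the contraaction. -/
theorem ract_contraMap (φ : H.Dual) (a : A) (z : C.tensor D) :
    C.tensorRact D (op a) (C.contraMap hH D φ z) =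
      C.contraMap hH D (H.homRact _ (op a) φ) z := by
  rw [← LinearMap.comp_apply]
  refine LinearMap.congr_fun (C.tensor_hom_ext D fun m n => ?_) z
  rw [LinearMap.comp_apply, contraMap_tmul, contraMap_tmul, map_sw]
  simp only [tensorRact_tmul]
  rw [D.sw_takeuchi (C.bal_contra D hH φ m)]
  refine sw_congr _ fun u n' => ?_
  rw [LeftBialgebroid.adjDual_mul, LeftBialgebroid.adjDual_t]

theorem rankOne_ract (φ : H.Dual) (a : A) (m : M) (ψ : H.Dual) (hψ : ∀ u, ψ u = a * φ u) :
    H.rankOne C.ract (C.ract (op a) m) φ = H.rankOne C.ract m ψ := by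
  apply Subtype.ext
  ext u
  rw [AeRing.rankOne_apply, AeRing.rankOne_apply, hψ, op_mul, map_mul]
  rfl

/-- In $n_{-1}\rightharpoonup\varepsilon=\varepsilon(n_{-1})\varepsilon$ the scalar crosses
$\otimes_A$ to $n_0$; the unit law of $M$ and the counit law of $N$ remain. -/
theorem contraMap_counit (z : C.tensor D) : C.contraMap hH D H.counitDual z = z := by
  refine LinearMap.congr_fun (g := LinearMap.id) (C.tensor_hom_ext D fun m n => ?_) z
  rw [contraMap_tmul, LinearMap.id_apply]
  conv_rhs => rw [← D.sw_counit n, map_sw]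
  refine sw_congr _ fun u n' => ?_
  rw [← C.rankOne_ract H.counitDual (H.ε u) m _ (LeftBialgebroid.adjDual_counit_apply hH u),
    C.γ_unit, tmul_rel]

/-- The left side is
$\gamma_M(m\langle(n_{-2}\rightharpoonup\psi)(n_{-1}\rightharpoonup\phi),-\rangle)\otimes n_0$ by
`γ_conv`. Coassociativity of $N$ and the module algebra property of $U^*$ combine the two factors.
-/
theorem contraMap_conv (ψ φ : H.Dual) (z : C.tensor D) :
    C.contraMap hH D φ (C.contraMap hH D ψ z) =
      C.contraMap hH D (LeftBialgebroid.conv ψ φ) z := by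
  rw [← LinearMap.comp_apply]
  refine LinearMap.congr_fun (C.tensor_hom_ext D fun m n => ?_) z
  rw [LinearMap.comp_apply, contraMap_tmul, contraMap_tmul, map_sw]
  simp only [contraMap_tmul, C.γ_conv, LeftBialgebroid.adjDual_conv]
  rw [← D.sw_coassoc (B := fun u v n' => C.tmul D (C.γ (H.rankOne C.ract m
    (LeftBialgebroid.conv (LeftBialgebroid.adjDual hH ψ u) (LeftBialgebroid.adjDual hH φ v)))) n')]
  · refine sw_congr _ fun u n' => ?_
    simp only [sw, map_sum, LinearMap.sum_apply]
  · intro n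
    exact (LeftBialgebroid.bal_adjDual_conv hH ψ φ).comp
      (((C.tmul D).flip n) ∘ₗ C.γ ∘ₗ H.rankOne C.ract m)
  · intro u
    -- Read back as an iterated contraaction, the term is an instance of `bal_contra`.
    simp only [← C.γ_conv]
    exact C.bal_contra D hH φ _

end RightContramodule

/-! ### Dual bases and reduction to rank one maps. -/

namespace AeRing

variable {E : AeRing k A U} {r : ℕ} {e : Fin r → U} {e' : Fin r → E.Dual}

theorem IsDualBasis.apply_eq_sum (hb : E.IsDualBasis e e') {ρ : Aᵐᵒᵖ →ₐ[k] Module.End k M}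
    (f : E.HomA ρ) (u : U) : f u = ∑ i, ρ (op (e' i u)) (f (e i)) := by
  conv_lhs => rw [hb u, map_sum]
  exact Finset.sum_congr rfl fun i _ => f.2 _ _

theorem IsDualBasis.eq_sum_rankOne (hb : E.IsDualBasis e e') {ρ : Aᵐᵒᵖ →ₐ[k] Module.End k M}
    (f : E.HomA ρ) : f = ∑ i, E.rankOne ρ (f (e i)) (e' i) := by
  apply Subtype.ext
  ext u
  rw [hb.apply_eq_sum f u]
  simp

theorem IsDualBasis.linearMap_ext (hb : E.IsDualBasis e e') {ρ : Aᵐᵒᵖ →ₐ[k] Module.End k M}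
    {F G : E.HomA ρ →ₗ[k] P} (h : ∀ m φ, F (E.rankOne ρ m φ) = G (E.rankOne ρ m φ)) : F = G := by
  ext f
  rw [hb.eq_sum_rankOne f, map_sum, map_sum]
  exact Finset.sum_congr rfl fun i _ => h _ _

theorem FGProjective.exists_isDualBasis (h : E.FGProjective) :
    ∃ (r : ℕ) (e : Fin r → U) (e' : Fin r → E.Dual), E.IsDualBasis e e' := by
  let _ : Module Aᵐᵒᵖ U := Module.compHom U (E.t : Aᵐᵒᵖ →+* U)
  obtain ⟨h1, h2⟩ := h
  -- $U_\lhd$ is a retract of a free module of rank `r`: the $e_i$ are the images of the standard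
  -- basis, and the $e^i$ are the coordinates of the section.
  obtain ⟨r, f, g, hf, hg, hfg⟩ := Module.Finite.exists_comp_eq_id_of_projective Aᵐᵒᵖ U
  have hs : ∀ (a : Aᵐᵒᵖ) (u : U), a • u = E.t a * u := fun _ _ => rfl
  refine ⟨r, fun i => f (Pi.single i 1), fun i => ⟨⟨⟨fun u => (g u i).unop, ?_⟩, ?_⟩, ?_⟩, ?_⟩
  · intro u v
    simp
  · intro c u
    -- The section is only known to be $A^{\rm op}$-linear; $k$-linearity follows because $t$ is a
    -- $k$-algebra map.
    have : c • u = (algebraMap k Aᵐᵒᵖ c) • u := by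
      rw [hs, AlgHom.commutes, Algebra.smul_def]
    simp [this, Algebra.smul_def, Algebra.commutes]
  · intro a u
    change (g (E.t a * u) i).unop = (g u i).unop * a.unop
    rw [← hs, map_smul]
    simp
  · intro u
    have h1 := LinearMap.congr_fun hfg u
    rw [LinearMap.comp_apply, LinearMap.id_apply] at h1
    conv_lhs => rw [← h1, ← Finset.univ_sum_single (g u), map_sum]
    refine Finset.sum_congr rfl fun i _ => ?_
    change _ = E.t (g u i) * _
    rw [← hs, ← map_smul, ← Pi.single_smul]
    simp

end AeRing

/-! ### The contramodule $M\otimes_AN$. -/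

namespace RightContramodule

variable (C : RightContramodule H M) (D : LeftComodule H N) (hH : H.IsLeftHopf)
variable {r : ℕ} (e : Fin r → U) (e' : Fin r → H.Dual)

/-- The contraaction `f ↦ ∑ j, γ(f(e_j)'⟨f(e_j)''₋₁ ⇀ e^j, -⟩) ⊗ f(e_j)''₀` on `M ⊗_A N`. -/
noncomputable def tensorγ : H.HomA (C.tensorRact D) →ₗ[k] C.tensor D :=
  ∑ j, C.contraMap hH D (e' j) ∘ₗ LinearMap.applyₗ (e j) ∘ₗ (H.HomA (C.tensorRact D)).subtype

theorem tensorγ_apply (f : H.HomA (C.tensorRact D)) :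
    C.tensorγ D hH e e' f = ∑ j, C.contraMap hH D (e' j) (f (e j)) := by
  simp [tensorγ]

variable {e e'}

/-- By balancedness the sum is $z\cdot\sum_j\phi(e_j)e^j=z\cdot\phi$. The dual basis has dropped
out, which gives independence of its choice in `tensorγ_eq`. -/
theorem tensorγ_rankOne (hb : H.IsDualBasis e e') (z : C.tensor D) (φ : H.Dual) :
    C.tensorγ D hH e e' (H.rankOne _ z φ) = C.contraMap hH D φ z := by
  rw [tensorγ_apply]
  simp only [AeRing.rankOne_apply, contraMap_ract]
  have : ∑ j, LeftBialgebroid.adjDual hH (e' j) (H.s (φ (e j))) = φ := by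
    apply Subtype.ext
    ext u
    rw [hb.apply_eq_sum φ u]
    simp [LeftBialgebroid.adjDual_s_apply]
  rw [← contraMap_sum, this]

theorem tensorγ_eq (hb : H.IsDualBasis e e') {q : ℕ} {d : Fin q → U} {d' : Fin q → H.Dual}
    (hd : H.IsDualBasis d d') (f : H.HomA (C.tensorRact D)) :
    C.tensorγ D hH e e' f = ∑ j, C.contraMap hH D (d' j) (f (d j)) := by
  conv_lhs => rw [hd.eq_sum_rankOne f, map_sum]
  simp only [C.tensorγ_rankOne D hH hb]

theorem tensorγ_ract (hb : H.IsDualBasis e e') (a : Aᵐᵒᵖ) (f : H.HomA (C.tensorRact D)) :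
    C.tensorγ D hH e e' (H.homRact _ a f) = C.tensorRact D a (C.tensorγ D hH e e' f) := by
  rw [← LinearMap.comp_apply, ← LinearMap.comp_apply]
  refine LinearMap.congr_fun (hb.linearMap_ext fun z φ => ?_) f
  rw [LinearMap.comp_apply, LinearMap.comp_apply, C.tensorγ_rankOne D hH hb]
  have : H.homRact _ a (H.rankOne (C.tensorRact D) z φ) =
      H.rankOne _ z (H.homRact _ a φ) := by
    apply Subtype.ext
    ext u
    rfl
  rw [this, C.tensorγ_rankOne D hH hb]
  exact (C.ract_contraMap D hH φ a.unop z).symm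

/-- The contramodule `M ⊗_A N`. -/
noncomputable def tensorContramodule (hb : H.IsDualBasis e e') :
    RightContramodule H (C.tensor D) where
  ract := C.tensorRact D
  γ := C.tensorγ D hH e e'
  γ_ract := C.tensorγ_ract D hH hb
  γ_assoc h := by
    -- Expanding `h` along the dual basis in both variables writes $u\mapsto h(u_1)(u_2)$ as a sum
    -- of rank one maps with functionals $e^ie^j$, so contraassociativity reduces to
    -- `contraMap_conv`.
    have e1 : H.homComul h = ∑ j, ∑ i, H.rankOne (C.tensorRact D) ((h.1 (e j)).1 (e i))
        (LeftBialgebroid.conv (e' i) (e' j)) := by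
      apply Subtype.ext
      ext v
      rw [LeftBialgebroid.homComul_apply]
      have : ∀ x y, (h.1 x).1 y = ∑ j, ∑ i, C.tensorRact D
          (op ((e' i) (H.s ((e' j) x) * y))) ((h.1 (e j)).1 (e i)) := by
        intro x y
        have := hb.apply_eq_sum (M := H.HomA (C.tensorRact D)) (ρ := H.homRact (C.tensorRact D)) h x
        rw [this]
        simp only [AddSubmonoidClass.coe_finsetSum, LinearMap.coe_sum, Finset.sum_apply,
          AeRing.homRact_apply]
        exact Finset.sum_congr rfl fun j _ => hb.apply_eq_sum _ _
      rw [sw_congr _ this]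
      simp only [AddSubmonoidClass.coe_finsetSum, LinearMap.coe_sum, Finset.sum_apply,
        AeRing.rankOne_apply, LeftBialgebroid.conv_apply]
      simp only [sw]
      rw [Finset.sum_comm]
      refine Finset.sum_congr rfl fun j _ => ?_
      rw [Finset.sum_comm]
      refine Finset.sum_congr rfl fun i _ => ?_
      simp
    rw [e1, tensorγ_apply]
    simp only [map_sum, C.tensorγ_rankOne D hH hb, ← contraMap_conv]
    refine Finset.sum_congr rfl fun j _ => ?_
    rw [← map_sum, ← tensorγ_apply]
    rfl
  γ_unit z := by rw [C.tensorγ_rankOne D hH hb, contraMap_counit]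

end RightContramodule

end Coefficients

/-! ### The two compatibility conditions in Sweedler form. -/

section YetterDrinfeld

open BalTensor

variable {k A U : Type*} [CommRing k] [Ring A] [Algebra k A] [Ring U] [Algebra k U]
variable {H : LeftBialgebroid k A U}
variable {M : Type*} [AddCommGroup M] [Module k M] {N : Type*} [AddCommGroup N] [Module k N]
variable {P : Type*} [AddCommGroup P] [Module k P]

/-- Bridges the `Fin`-indexed representatives of `YDModule.compat` and the finite sets behind `sw`.
-/
theorem Finset.sum_equivFin_symm {α Q : Type*} [AddCommMonoid Q] (S : Finset α) (F : α → Q) :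
    ∑ i, F (S.equivFin.symm i).1 = ∑ p ∈ S, F p := by
  rw [← Finset.sum_coe_sort S]
  exact Equiv.sum_comp S.equivFin.symm (fun p => F p.1)

theorem BalTensor.sw_linearMap_apply {A' M' N' : Type*} [AddCommGroup M'] [Module k M']
    [AddCommGroup N'] [Module k N'] {ρ : A' → Module.End k M'} {l : A' → Module.End k N'}
    (z : BalTensor ρ l) (B : M' → N' → M →ₗ[k] P) (m : M) :
    (sw z B) m = sw z (fun x y => B x y m) :=
  map_sw (LinearMap.applyₗ m) z B

/-- A factor $s(a)$ on the second leg leaves $\rightharpoonup$ as the left $A$-action on values, and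
`γ_lact` converts it into $t(a)$ on the first leg. No aYD condition is assumed, because the lemma is
also needed for $M\otimes_AN$ in order to establish that condition. -/
theorem RightContramodule.bal_γ_adj (hH : H.IsLeftHopf) (C : RightContramodule H M)
    (act : U →ₐ[k] Module.End k M) (hs : ∀ a m, act (H.s a) m = C.lact a m)
    (ht : ∀ a, act (H.t a) = C.ract a) (f : H.HomA C.ract) :
    Bal H.rt H.ls (fun p q =>
      C.γ (H.homMulRight C.ract p (LeftBialgebroid.adj hH act C.ract ht f q))) := by
  constructor
  · exact fun _ => ⟨fun _ _ => by simp, fun _ _ => by simp⟩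
  · exact fun _ => ⟨fun _ _ => by simp, fun _ _ => by simp⟩
  · intro a p q
    symm
    rw [C.γ_lact a (H.homMulRight C.ract p (LeftBialgebroid.adj hH act C.ract ht f q))]
    · congr 1
      apply Subtype.ext
      ext w
      simp [mul_assoc]
    · intro u
      rw [← hs, AeRing.homMulRight_apply, AeRing.homMulRight_apply, AeRing.ls_apply,
        LeftBialgebroid.adj_s_mul]

/-- `u γ(f) = γ((u₂ ⇀ f)((-) u₁))`. -/
theorem AYDContramodule.act_γ {hH : H.IsLeftHopf} (C : AYDContramodule H hH M) (u : U)
    (f : H.HomA C.ract) : C.act u (C.γ f) = sw (H.Δ u) (fun p q =>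
      C.γ (H.homMulRight C.ract p (LeftBialgebroid.adj hH C.act C.ract C.act_t f q))) := by
  obtain ⟨X, hX⟩ := Submodule.Quotient.mk_surjective _ (H.Δ u)
  rw [C.compat u f X hX, ← hX]
  exact Bal.lift_tensor (B := ((H.homMulRight C.ract).compl₂
    (LeftBialgebroid.adj hH C.act C.ract C.act_t f)).compr₂ C.γ)
    (C.bal_γ_adj hH C.act C.act_s C.act_t f) X

/-- `(u₁ n)₋₁ u₂ ⊗ (u₁ n)₀ = u₁ n₋₁ ⊗ u₂ n₀`. -/
theorem YDModule.sw_compat (D : YDModule H N) {B : U → N → P} (h : Bal H.rt D.lact B) (u : U)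
    (n : N) :
    sw (H.Δ u) (fun x y => sw (D.coact (D.act x n)) (fun v n' => B (v * y) n')) =
      sw (H.Δ u) (fun x y => sw (D.coact n) (fun v n' => B (x * v) (D.act y n'))) := by
  have h1 := (exists_eq_sum_mk (H.Δ u)).choose_spec
  have h2 := (exists_eq_sum_mk (D.coact n)).choose_spec
  set S := (exists_eq_sum_mk (H.Δ u)).choose with hS
  set T := (exists_eq_sum_mk (D.coact n)).choose with hT
  -- The axiom is used for the representatives that `sw` has chosen, so the left summand need not be
  -- balanced in the legs of $\Delta(u)$.
  have key := D.compat u n S.card (fun i => (S.equivFin.symm i).1.1)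
    (fun i => (S.equivFin.symm i).1.2) (∑ p ∈ T, p.1 ⊗ₜ p.2)
    (by rw [S.sum_equivFin_symm (fun p => BalTensor.mk H.rt H.ls p.1 p.2), ← h1])
    (by rw [h2]; exact map_sum (balRel _ _).mkQ _ _)
  rw [S.sum_equivFin_symm (fun p => H.fstMulRight D.lact p.2 (D.coact (D.act p.1 n))),
    S.sum_equivFin_symm (fun p => TensorProduct.map (LinearMap.mulLeft k p.1) (D.act p.2)
      (∑ p ∈ T, p.1 ⊗ₜ p.2))] at key
  have key' := congrArg h.lift key
  rw [map_sum] at key'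
  have e1 : ∀ p : U × U, h.lift (H.fstMulRight D.lact p.2 (D.coact (D.act p.1 n))) =
      sw (D.coact (D.act p.1 n)) (fun v n' => B (v * p.2) n') := by
    intro p
    rw [← h.sw_eq]
    exact h.sw_apply _ (fun v => v * p.2) (fun n' => n') (by simp) _
  have e2 : h.lift (Submodule.Quotient.mk (∑ p ∈ S, TensorProduct.map (LinearMap.mulLeft k p.1)
      (D.act p.2) (∑ p ∈ T, p.1 ⊗ₜ p.2))) =
      ∑ p ∈ S, ∑ q ∈ T, B (p.1 * q.1) (D.act p.2 q.2) := by
    simp only [map_sum, TensorProduct.map_tmul]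
    change h.lift ((balRel _ _).mkQ _) = _
    simp only [map_sum]
    exact Finset.sum_congr rfl fun p _ => Finset.sum_congr rfl fun q _ => h.lift_mk _ _
  rw [e2, Finset.sum_congr rfl fun p _ => e1 p] at key'
  exact key'

/-! ### The diagonal action and the aYD condition on $M\otimes_AN$. -/

namespace AYDContramodule

variable {hH : H.IsLeftHopf} (C : AYDContramodule H hH M) (D : YDModule H N)

theorem bal_tmul_act (m : M) (n : N) : Bal H.rt H.ls (fun x y =>
    C.toRightContramodule.tmul D.toLeftComodule (C.act x m) (D.act y n)) := by
  constructor
  · exact fun _ => ⟨fun _ _ => by simp, fun _ _ => by simp⟩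
  · exact fun _ => ⟨fun _ _ => by simp, fun _ _ => by simp⟩
  · intro a x y
    rw [AeRing.rt_apply, AeRing.ls_apply, map_mul C.act, map_mul D.act, C.act_t, D.act_s]
    exact C.tmul_rel D.toLeftComodule a _ _

theorem diag_eq_sw (m : M) (n : N) (z : H.UU) : C.diag D m n z = sw z (fun x y =>
    C.toRightContramodule.tmul D.toLeftComodule (C.act x m) (D.act y n)) := by
  rw [← sw_eq_apply]
  exact sw_congr _ fun x y => BalTensor.lift_mk _ _ x y

/-- The diagonal action of an element of `U` on `M ⊗_A N`. -/
noncomputable def tensorActAux (u : U) :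
    Module.End k (C.toRightContramodule.tensor D.toLeftComodule) :=
  BalTensor.lift (LinearMap.mk₂ k (fun m n => sw (H.Δ u) (fun x y =>
      C.toRightContramodule.tmul D.toLeftComodule (C.act x m) (D.act y n)))
    (by intros; simp [sw, Finset.sum_add_distrib]) (by intros; simp [sw, Finset.smul_sum])
    (by intros; simp [sw, Finset.sum_add_distrib]) (by intros; simp [sw, Finset.smul_sum])) (by
    intro a m n
    -- The action descends to $\otimes_A$ because $u_1t(a)\otimes u_2=u_1\otimes u_2s(a)$.
    have := LeftBialgebroid.sw_takeuchi H (C.bal_tmul_act D m n) a u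
    simpa [C.act_t, D.act_s] using this)

theorem tensorActAux_tmul (u : U) (m : M) (n : N) :
    C.tensorActAux D u (C.toRightContramodule.tmul D.toLeftComodule m n) =
      sw (H.Δ u) (fun x y =>
        C.toRightContramodule.tmul D.toLeftComodule (C.act x m) (D.act y n)) :=
  BalTensor.lift_mk _ _ m n

/-- The diagonal action of `U` on `M ⊗_A N`. -/
noncomputable def tensorAct :
    U →ₐ[k] Module.End k (C.toRightContramodule.tensor D.toLeftComodule) :=
  AlgHom.ofLinearMap
    { toFun := C.tensorActAux D
      map_add' := fun u v => by
        apply C.tensor_hom_ext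
        intro m n
        rw [LinearMap.add_apply, tensorActAux_tmul, tensorActAux_tmul, tensorActAux_tmul, map_add,
          (C.bal_tmul_act D m n).sw_add]
      map_smul' := fun c u => by
        apply C.tensor_hom_ext
        intro m n
        rw [LinearMap.smul_apply, tensorActAux_tmul, tensorActAux_tmul, map_smul,
          (C.bal_tmul_act D m n).sw_smul, RingHom.id_apply] }
    (by
      apply C.tensor_hom_ext
      intro m n
      refine (C.tensorActAux_tmul D 1 m n).trans ?_
      rw [LeftBialgebroid.sw_Δ_one H (C.bal_tmul_act D m n)]
      simp)
    (by
      intro u v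
      apply C.tensor_hom_ext
      intro m n
      refine (C.tensorActAux_tmul D _ m n).trans ?_
      rw [LeftBialgebroid.sw_Δ_mul H (C.bal_tmul_act D m n), sw_sw_comm]
      change _ = C.tensorActAux D u (C.tensorActAux D v _)
      rw [tensorActAux_tmul, map_sw]
      refine sw_congr _ fun p q => ?_
      rw [tensorActAux_tmul]
      refine sw_congr _ fun x y => ?_
      rw [map_mul, map_mul]
      rfl)

theorem tensorAct_tmul (u : U) (m : M) (n : N) :
    C.tensorAct D u (C.toRightContramodule.tmul D.toLeftComodule m n) =
      sw (H.Δ u) (fun x y =>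
        C.toRightContramodule.tmul D.toLeftComodule (C.act x m) (D.act y n)) :=
  C.tensorActAux_tmul D u m n

theorem tensorAct_s_tmul (a : A) (m : M) (n : N) :
    C.tensorAct D (H.s a) (C.toRightContramodule.tmul D.toLeftComodule m n) =
      C.toRightContramodule.tmul D.toLeftComodule (C.act (H.s a) m) n := by
  have hb := C.bal_tmul_act D m n
  rw [tensorAct_tmul, ← mul_one (H.s a), LeftBialgebroid.sw_Δ_s H hb, H.Δ_one, Bal.sw_mk]
  · simp
  · constructor
    · exact fun _ => ⟨fun _ _ => by simp [mul_add], fun _ _ => by simp⟩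
    · exact fun _ => ⟨fun _ _ => by simp, fun _ _ => by simp⟩
    · intro b x y
      rw [← hb.bal, AeRing.rt_apply, AeRing.rt_apply, ← mul_assoc, H.s_t_comm, mul_assoc]

theorem tensorAct_t (a : Aᵐᵒᵖ) :
    C.tensorAct D (H.t a) = C.toRightContramodule.tensorRact D.toLeftComodule a := by
  induction a with | _ a
  apply C.tensor_hom_ext
  intro m n
  have hb := C.bal_tmul_act D m n
  rw [tensorAct_tmul, RightContramodule.tensorRact_tmul, ← mul_one (H.t _),
    LeftBialgebroid.sw_Δ_t H hb, H.Δ_one, Bal.sw_mk]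
  · simp [D.act_t]
  · constructor
    · exact fun _ => ⟨fun _ _ => by simp, fun _ _ => by simp⟩
    · exact fun _ => ⟨fun _ _ => by simp [mul_add], fun _ _ => by simp⟩
    · intro b x y
      rw [hb.bal, AeRing.ls_apply, AeRing.ls_apply, ← mul_assoc, H.s_t_comm, mul_assoc]

theorem act_s_ract (a b : A) (m : M) :
    C.act (H.s a) (C.ract (op b) m) = C.ract (op b) (C.act (H.s a) m) := by
  rw [← C.act_t, ← Module.End.mul_apply, ← map_mul, H.s_t_comm, map_mul]
  rfl

/-- Identifies the left $A$-action through $s$ with the one induced by the contraaction. It holds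
because $u\rightharpoonup\varepsilon((-)s(a))=\varepsilon(u)\,\varepsilon((-)s(a))$, after which the
counit law of $N$ applies. -/
theorem tensorAct_s (a : A) (z : C.toRightContramodule.tensor D.toLeftComodule) :
    C.tensorAct D (H.s a) z =
      C.toRightContramodule.contraMap hH D.toLeftComodule (H.sDual a) z := by
  refine LinearMap.congr_fun (C.tensor_hom_ext _ fun m n => ?_) z
  rw [tensorAct_s_tmul, RightContramodule.contraMap_tmul]
  conv_lhs => rw [← D.sw_counit n, map_sw]
  refine sw_congr _ fun u n' => ?_
  rw [← C.rankOne_ract (H.sDual a) (H.ε u) m _ (LeftBialgebroid.adjDual_sDual_apply hH a u),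
    ← C.tmul_rel, ← act_s_ract, C.act_s]
  rfl

/-- `γ((r m)⟨v ⇀ φ, (-) p⟩) ⊗ n`. -/
noncomputable def contraTerm (φ : H.Dual) (m : M) (p r v : U) (n : N) :
    C.toRightContramodule.tensor D.toLeftComodule :=
  C.toRightContramodule.tmul D.toLeftComodule (C.γ (H.rankOne C.ract (C.act r m)
    (LeftBialgebroid.adjDual hH (H.homMulRight _ p φ) v))) n

variable (φ : H.Dual) (m : M)

/-- As in `bal_γ_adj`, `γ_lact` trades $s(a)$ acting on the coefficient for $t(a)$ in the argument.
The three balancedness lemmas cover the consecutive pairs of legs that `sw_coassoc_inner` needs. -/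
theorem bal_contraTerm₁ (v : U) (n : N) :
    Bal H.rt H.ls (fun p r => C.contraTerm D φ m p r v n) := by
  simp only [contraTerm, LeftBialgebroid.adjDual_homMulRight]
  constructor
  · exact fun _ => ⟨fun _ _ => by simp, fun _ _ => by simp⟩
  · exact fun _ => ⟨fun _ _ => by simp, fun _ _ => by simp⟩
  · intro a p r
    congr 2
    symm
    rw [C.γ_lact a (H.rankOne C.ract (C.act r m)
      (H.homMulRight _ p (LeftBialgebroid.adjDual hH φ v)))]
    · congr 1
      apply Subtype.ext
      ext w
      simp [mul_assoc]
    · intro u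
      rw [← C.act_s, AeRing.rankOne_apply, AeRing.rankOne_apply, act_s_ract, AeRing.ls_apply,
        map_mul C.act]
      rfl

theorem bal_contraTerm₂ (p : U) (n : N) :
    Bal H.rt H.ls (fun r v => C.contraTerm D φ m p r v n) := by
  constructor
  · exact fun _ => ⟨fun _ _ => by simp [contraTerm], fun _ _ => by simp [contraTerm]⟩
  · exact fun _ => ⟨fun _ _ => by simp [contraTerm], fun _ _ => by simp [contraTerm]⟩
  · intro a r v
    rw [contraTerm, AeRing.rt_apply, map_mul, C.act_t, Module.End.mul_apply,
      C.rankOne_ract _ a _ _ (LeftBialgebroid.adjDual_s_mul hH _ a v)]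
    rfl

theorem bal_contraTerm₃ (p r : U) :
    Bal H.rt D.lact (fun v n => C.contraTerm D φ m p r v n) :=
  C.bal_contra D.toLeftComodule hH _ _

/-- The aYD condition on $M$ is applied to $u_1\gamma_M(\cdot)$, and `adj_rankOne` then splits the
leg that acts by $\rightharpoonup$. -/
theorem tensorAct_contraMap_tmul (u : U) (n : N) :
    C.tensorAct D u (C.contraMap hH D.toLeftComodule φ (C.tmul D.toLeftComodule m n)) =
      sw (D.coact n) (fun v n' => sw (H.Δ u) (fun x y => sw (H.Δ x) (fun p q =>
        sw (H.Δ q) (fun r s => C.contraTerm D φ m p r (s * v) (D.act y n'))))) := by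
  rw [RightContramodule.contraMap_tmul, map_sw]
  refine sw_congr _ fun v n' => ?_
  rw [tensorAct_tmul]
  refine sw_congr _ fun x y => ?_
  rw [C.act_γ, ← LinearMap.flip_apply, map_sw]
  refine sw_congr _ fun p q => ?_
  rw [LeftBialgebroid.adj_rankOne, map_sw, map_sw, map_sw]
  refine sw_congr _ fun r s => ?_
  rw [contraTerm, LeftBialgebroid.adjDual_homMulRight, LeftBialgebroid.adjDual_mul]
  rfl

/-- Coassociativity brings the leg acting on $n$ and the one acting on $\phi$ into one coproduct;
there the Yetter–Drinfel'd condition replaces $(y_1n)_{-1}y_2\otimes(y_1n)_0$ by $y_1n_{-1}\otimes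
y_2n_0$. -/
theorem sw_contraMap_tensorAct_tmul (p q : U) (n : N) :
    sw (H.Δ q) (fun x s => C.contraMap hH D.toLeftComodule
      (H.homMulRight _ p (LeftBialgebroid.adjDual hH φ s))
      (C.tensorAct D x (C.tmul D.toLeftComodule m n))) =
    sw (D.coact n) (fun v n' => sw (H.Δ q) (fun r y => sw (H.Δ y) (fun w s =>
        C.contraTerm D φ m p r (w * v) (D.act s n')))) := by
  have e : ∀ x s, C.contraMap hH D.toLeftComodule
      (H.homMulRight _ p (LeftBialgebroid.adjDual hH φ s))
      (C.tensorAct D x (C.tmul D.toLeftComodule m n)) = sw (H.Δ x) (fun r w =>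
        sw (D.coact (D.act w n)) (fun v n' => C.contraTerm D φ m p r (v * s) n')) := by
    intro x s
    rw [tensorAct_tmul, map_sw]
    refine sw_congr _ fun r w => ?_
    rw [RightContramodule.contraMap_tmul]
    refine sw_congr _ fun v n' => ?_
    rw [contraTerm, LeftBialgebroid.adjDual_homMulRight, LeftBialgebroid.adjDual_homMulRight,
      LeftBialgebroid.adjDual_mul]
  have h2 := C.bal_contraTerm₂ D φ m p
  have h3 := C.bal_contraTerm₃ D φ m p
  have h3' : ∀ r s, Bal H.rt D.lact (fun v n => C.contraTerm D φ m p r (v * s) n) := by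
    intro r s
    constructor
    · exact fun n => ⟨fun _ _ => by simp [add_mul, ((h3 r).left n).map_add],
        fun _ _ => by simp [((h3 r).left n).map_smul]⟩
    · exact fun v => (h3 r).right _
    · intro a v n
      rw [← (h3 r).bal, AeRing.rt_apply, AeRing.rt_apply, mul_assoc]
  simp only [e]
  rw [LeftBialgebroid.sw_coassoc H (B := fun r w s =>
    sw (D.coact (D.act w n)) (fun v n' => C.contraTerm D φ m p r (v * s) n'))]
  · have e2 : ∀ r y, sw (H.Δ y) (fun w s =>
        sw (D.coact (D.act w n)) (fun v n' => C.contraTerm D φ m p r (v * s) n')) =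
        sw (D.coact n) (fun v n' => sw (H.Δ y) (fun w s =>
          C.contraTerm D φ m p r (w * v) (D.act s n'))) := by
      intro r y
      rw [D.sw_compat (h3 r), sw_sw_comm]
    simp only [e2]
    rw [sw_sw_comm]
  · intro s
    constructor
    · exact fun _ => ⟨fun _ _ => by simp [sw, contraTerm, Finset.sum_add_distrib],
        fun _ _ => by simp [sw, contraTerm, Finset.smul_sum]⟩
    · exact fun r => ⟨fun _ _ => by simp [(h3' r s).sw_add],
        fun _ _ => by simp [(h3' r s).sw_smul]⟩
    · intro a r w
      rw [AeRing.ls_apply, map_mul D.act, D.act_s, Module.End.mul_apply,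
        D.sw_coact_lact (h3' r s)]
      refine sw_congr _ fun v n' => ?_
      rw [(h2 n').bal, AeRing.ls_apply, mul_assoc]
  · intro r
    constructor
    · exact fun s => ⟨fun _ _ => by simp [(h3' r s).sw_add],
        fun _ _ => by simp [(h3' r s).sw_smul]⟩
    · exact fun _ => ⟨fun _ _ => by simp [sw, contraTerm, mul_add, Finset.sum_add_distrib],
        fun _ _ => by simp [sw, contraTerm, Finset.smul_sum]⟩
    · intro a w s
      rw [AeRing.rt_apply, map_mul D.act, D.act_t, Module.End.mul_apply,
        D.sw_coact_ract (h3' r s)]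
      refine sw_congr _ fun v n' => ?_
      rw [AeRing.ls_apply, mul_assoc]

/-- `u (z φ) = (u₂ z) ((u₃ ⇀ φ)((-) u₁))` for `z` in `M ⊗_A N` and `φ` in `U^*`. -/
theorem tensorAct_contraMap (u : U) (z : C.tensor D.toLeftComodule) :
    C.tensorAct D u (C.contraMap hH D.toLeftComodule φ z) =
      sw (H.Δ u) (fun p q => sw (H.Δ q) (fun x s => C.contraMap hH D.toLeftComodule
        (H.homMulRight _ p (LeftBialgebroid.adjDual hH φ s)) (C.tensorAct D x z))) := by
  have : C.tensorAct D u ∘ₗ C.contraMap hH D.toLeftComodule φ =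
      sw (H.Δ u) (fun p q => sw (H.Δ q) (fun x s => C.contraMap hH D.toLeftComodule
        (H.homMulRight _ p (LeftBialgebroid.adjDual hH φ s)) ∘ₗ C.tensorAct D x)) := by
    apply C.tensor_hom_ext
    intro m n
    simp only [sw_linearMap_apply, LinearMap.comp_apply, tensorAct_contraMap_tmul,
      sw_contraMap_tensorAct_tmul]
    rw [sw_sw_comm (H.Δ u)]
    refine sw_congr _ fun v n' => ?_
    -- Both sides are now `contraTerm` at $u_1,\,u_2,\,u_3v,\,u_4n'$ and differ only in how the
    -- coproducts are nested.
    refine LeftBialgebroid.sw_coassoc_inner H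
      (G := fun p r s y => C.contraTerm D φ m p r (s * v) (D.act y n')) ?_ ?_ ?_ u
    · exact fun s y => C.bal_contraTerm₁ D φ m _ _
    · exact fun p y => (C.bal_contraTerm₂ D φ m p _).mulRight v
    · intro p r
      have h3 := C.bal_contraTerm₃ D φ m p r
      constructor
      · exact fun _ => ⟨fun _ _ => by simp [add_mul, (h3.left _).map_add],
          fun _ _ => by simp [(h3.left _).map_smul]⟩
      · exact fun _ => ⟨fun _ _ => by simp [(h3.right _).map_add],
          fun _ _ => by simp [(h3.right _).map_smul]⟩
      · intro a s y
        rw [AeRing.rt_apply, AeRing.ls_apply, map_mul D.act, D.act_s, Module.End.mul_apply,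
          ← h3.bal, AeRing.rt_apply, mul_assoc]
  have := LinearMap.congr_fun this z
  simpa only [sw_linearMap_apply, LinearMap.comp_apply] using this

variable {r : ℕ} {e : Fin r → U} {e' : Fin r → H.Dual}

/-- Both sides are additive in `f`, so rank one maps suffice; for these `adj_rankOne`, applied to
$M\otimes_AN$, turns the claim into `tensorAct_contraMap`. -/
theorem tensorAct_tensorγ (hb : H.IsDualBasis e e') (u : U)
    (f : H.HomA (C.tensorRact D.toLeftComodule)) :
    C.tensorAct D u (C.tensorγ D.toLeftComodule hH e e' f) = sw (H.Δ u) (fun p q =>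
      C.tensorγ D.toLeftComodule hH e e' (H.homMulRight _ p
        (LeftBialgebroid.adj hH (C.tensorAct D) _ (C.tensorAct_t D) f q))) := by
  have e1 : ∀ z φ p q, C.tensorγ D.toLeftComodule hH e e' (H.homMulRight _ p
      (LeftBialgebroid.adj hH (C.tensorAct D) _ (C.tensorAct_t D) (H.rankOne _ z φ) q)) =
      sw (H.Δ q) (fun x s => C.contraMap hH D.toLeftComodule
        (H.homMulRight _ p (LeftBialgebroid.adjDual hH φ s)) (C.tensorAct D x z)) := by
    intro z φ p q
    rw [LeftBialgebroid.adj_rankOne]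
    simp only [sw, map_sum, ← C.tensorγ_rankOne D.toLeftComodule hH hb]
    rfl
  rw [hb.eq_sum_rankOne f]
  simp only [LeftBialgebroid.adj_sum, map_sum, C.tensorγ_rankOne D.toLeftComodule hH hb, e1,
    tensorAct_contraMap]
  simp only [sw]
  exact Finset.sum_comm

/-- The anti Yetter-Drinfel'd contramodule `M ⊗_A N`. -/
noncomputable def tensorAYD (hb : H.IsDualBasis e e') :
    AYDContramodule H hH (C.toRightContramodule.tensor D.toLeftComodule) where
  toRightContramodule := C.tensorContramodule D.toLeftComodule hH hb
  act := C.tensorAct D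
  act_s a z := (C.tensorAct_s D a z).trans (C.tensorγ_rankOne D.toLeftComodule hH hb z _).symm
  act_t := C.tensorAct_t D
  compat u f X hX := by
    have hs : ∀ a z, C.tensorAct D (H.s a) z =
        (C.tensorContramodule D.toLeftComodule hH hb).lact a z := fun a z =>
      (C.tensorAct_s D a z).trans (C.tensorγ_rankOne D.toLeftComodule hH hb z _).symm
    -- Balancedness extends the identity from the representative chosen by `sw` to an arbitrary `X`.
    have h1 := (C.tensorContramodule D.toLeftComodule hH hb).bal_γ_adj hH (C.tensorAct D) hs
      (C.tensorAct_t D) f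
    refine (C.tensorAct_tensorγ D hb u f).trans ?_
    rw [← hX]
    exact (Bal.lift_tensor (B := ((H.homMulRight _).compl₂
      (LeftBialgebroid.adj hH (C.tensorAct D) _ (C.tensorAct_t D) f)).compr₂
        (C.tensorContramodule D.toLeftComodule hH hb).γ) h1 X).symm

end AYDContramodule

end YetterDrinfeld

theorem proposition4p5 {k A U : Type*} [CommRing k] [Ring A] [Algebra k A] [Ring U] [Algebra k U]
    (H : LeftBialgebroid k A U) (hH : H.IsLeftHopf) (hfg : H.FGProjective)
    {M N : Type*} [AddCommGroup M] [Module k M] [AddCommGroup N] [Module k N] :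
    (∀ (C : RightContramodule H M) (D : LeftComodule H N),
      ∃ T : RightContramodule H (C.tensor D),
        (∀ a m n, T.ract (op a) (C.tmul D m n) = C.tmul D m (D.ract a n)) ∧
        (∀ (r : ℕ) (e : Fin r → U) (e' : Fin r → H.Dual), H.IsDualBasis e e' →
          ∀ f, T.γ f = ∑ j, C.contraMap hH D (e' j) (f (e j)))) ∧
    (∀ (C : AYDContramodule H hH M) (D : YDModule H N),
      ∃ T : AYDContramodule H hH (C.toRightContramodule.tensor D.toLeftComodule),
        (∀ a m n, T.ract (op a) (C.toRightContramodule.tmul D.toLeftComodule m n) =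
          C.toRightContramodule.tmul D.toLeftComodule m (D.toLeftComodule.ract a n)) ∧
        (∀ (r : ℕ) (e : Fin r → U) (e' : Fin r → H.Dual), H.IsDualBasis e e' →
          ∀ f, T.γ f =
            ∑ j, C.toRightContramodule.contraMap hH D.toLeftComodule (e' j) (f (e j))) ∧
        (∀ u m n, T.act u (C.toRightContramodule.tmul D.toLeftComodule m n) =
          C.diag D m n (H.Δ u))) := by
  -- One dual basis serves to build the structures; `tensorγ_eq` then yields the formula for every
  -- other one.
  obtain ⟨r, e, e', hb⟩ := hfg.exists_isDualBasis
  refine ⟨fun C D => ⟨C.tensorContramodule D hH hb, C.tensorRact_tmul D, ?_⟩,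
    fun C D => ⟨C.tensorAYD D hb, C.tensorRact_tmul D.toLeftComodule, ?_, ?_⟩⟩
  · exact fun q d d' hd f => C.tensorγ_eq D hH hb hd f
  · exact fun q d d' hd f => C.tensorγ_eq D.toLeftComodule hH hb hd f
  · exact fun u m n => (C.tensorAct_tmul D u m n).trans (C.diag_eq_sw D m n _).symm
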